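/- Write $\mathbb{Z}_+=\{0,1,2,\dots\}$. Consider sequences $\varphi_m:\mathbb{R}\to\mathbb{R}$, $m\in\mathbb{Z}_+$, of the form $$\varphi_m(x)=\Theta(x)\,q_m(H(x)),\qquad m\in\mathbb{Z}_+,\qquad (*)$$ where $\Theta:\mathbb{R}\to\mathbb{R}$ is a function, $H:\mathbb{R}\to(-1,1)$ is the inverse of a differentiable map $h$ from $(-1,1)$ onto $\mathbb{R}$ with $h'>0$, and $q_m$ ($\deg q_m=m$) are orthonormal polynomials with respect to $W(t)\,\mathrm{d}t$ on $(-1,1)$ for some integrable weight $W\ge 0$. For $\alpha,\beta>-1$ let $P_m^{(\alpha,\beta)}$ be the Jacobi polynomials, $g_m^{(\alpha,\beta)}=\int_{-1}^1(1-t)^\alpha(1+t)^\beta\,[P_m^{(\alpha,\beta)}(t)]^2\,\mathrm{d}t$, $$\tau_m^{(\alpha,\beta)}(x)=\frac{(-1)^m}{\sqrt{g_m^{(\alpha,\beta)}}}(1-\tanh x)^{(\alpha+1)/2}(1+\tanh x)^{(\beta+1)/2}P_m^{(\alpha,\beta)}(\tanh x),$$ $$b_m^{(\alpha,\beta)}=\sqrt{\frac{(m+1)(\alpha+m+1)(\beta+m+1)(\alpha+\beta+m+1)}{(\alpha+\beta+2m+1)(\alpha+\beta+2m+3)}},$$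 where for $m=0$ the common factor $\alpha+\beta+1$ is cancelled, i.e. $b_0^{(\alpha,\beta)}=\sqrt{(\alpha+1)(\beta+1)/(\alpha+\beta+3)}$. Suppose that $\{\varphi_m\}$ is of the form $(*)$, is orthonormal in $L_2(\mathbb{R})$, and has a skew-symmetric, tridiagonal, irreducible differentiation matrix $\mathcal{D}$, that is, $\varphi_m'=\sum_k\mathcal{D}_{m,k}\varphi_k$ for all $m$. Then there are $\alpha,\beta>-1$, $\kappa>0$, $c\in\mathbb{R}$ and signs $s_m\in\{1,-1\}$ such that, for all $m\in\mathbb{Z}_+$ and $x\in\mathbb{R}$, $$\varphi_m(x)=s_m\sqrt{\kappa}\;\tau_m^{(\alpha,\beta)}(\kappa x+c),\qquad \mathcal{D}_{m,m+1}=-\mathcal{D}_{m+1,m}=s_ms_{m+1}\,\kappa\,b_m^{(\alpha,\beta)},$$ and all other entries of $\mathcal{D}$ vanish. If $\mathcal{D}_{m,m+1}>0$ for all $m$, then $s_m$ does not depend on $m$, so that $\mathcal{D}_{m,m+1}=\kappa\,b_m^{(\alpha,\beta)}$. Conversely, for all $\alpha,\beta>-1$, $\kappa>0$, $c\in\mathbb{R}$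 and $s_m\in\{1,-1\}$, the functions $\varphi_m$ and the matrix $\mathcal{D}$ given by these formulas have all the properties supposed above. Moreover, the data in $(*)$ can be chosen so that $\Theta(x)=\theta(H(x))H'(x)W(H(x))$ for some $\theta:(-1,1)\to\mathbb{R}$ with $\theta\sqrt{W/h'}\in L_\infty(-1,1)$. -/

import Mathlib

open Polynomial MeasureTheory Set

noncomputable section

/-! ### Orthonormal polynomials and the mapped systems -/

/-- `W` is a weight on `(-1, 1)`: the density of a finite measure `W(t) dt` on `(-1, 1)`. -/
structure IsWeight (W : ℝ → ℝ) : Prop where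
  nonneg : ∀ t ∈ Ioo (-1 : ℝ) 1, 0 ≤ W t
  integrableOn : IntegrableOn W (Ioo (-1 : ℝ) 1)

/-- `q 0, q 1, …` are orthonormal polynomials with respect to `W(t) dt` on `(-1, 1)`; `q m` has
degree exactly `m`, and the signs of the leading coefficients are free. -/
structure IsOrthonormalPoly (W : ℝ → ℝ) (q : ℕ → ℝ[X]) : Prop where
  degree_eq : ∀ m, (q m).degree = (m : WithBot ℕ)
  integral_eq : ∀ m n,
    ∫ t in Ioo (-1 : ℝ) 1, (q m).eval t * (q n).eval t * W t = if m = n then 1 else 0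

/-- `h` maps `(-1, 1)` onto `ℝ` and is differentiable there with positive derivative, and
`H : ℝ → (-1, 1)` is its inverse. (Surjectivity of `h` is contained in `h (H x) = x`, and
`H (h t) = t` follows because `h` is strictly increasing on `(-1, 1)`.) -/
structure IsMapPair (h H : ℝ → ℝ) : Prop where
  differentiableAt : ∀ t ∈ Ioo (-1 : ℝ) 1, DifferentiableAt ℝ h t
  deriv_pos : ∀ t ∈ Ioo (-1 : ℝ) 1, 0 < deriv h t
  mem_Ioo : ∀ x, H x ∈ Ioo (-1 : ℝ) 1
  right_inv : ∀ x, h (H x) = x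

/-- `φ m x = Θ x * q m (H x)`, with `q` orthonormal polynomials for the weight `W` on `(-1, 1)` and
`H` the inverse of an admissible map `h : (-1, 1) → ℝ`. -/
structure IsMappedPolySystem (W : ℝ → ℝ) (q : ℕ → ℝ[X]) (h H Θ : ℝ → ℝ) (φ : ℕ → ℝ → ℝ) :
    Prop where
  weight : IsWeight W
  orthonormal : IsOrthonormalPoly W q
  map : IsMapPair h H
  eq : ∀ m x, φ m x = Θ x * (q m).eval (H x)

/-- `Θ` comes from a factor `θ` on `(-1, 1)` with `θ √(W / h') ∈ L∞(-1, 1)`, as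
`Θ(x) = θ(H(x)) H'(x) W(H(x))`; by the change of variables `x = h(t)` this means
`∫ f Θ (q m ∘ H) dx = ∫ θ (f ∘ h) (q m) W dt`. -/
structure IsCoefficientFactor (W h H Θ θ : ℝ → ℝ) : Prop where
  bounded : MemLp (fun t => θ t * √(W t / deriv h t)) ⊤ (volume.restrict (Ioo (-1 : ℝ) 1))
  eq : ∀ x, Θ x = θ (H x) * deriv H x * W (H x)

/-- The functions `φ 0, φ 1, …` form an orthonormal system in `L²(ℝ)`. -/
structure IsOrthonormalSystem (φ : ℕ → ℝ → ℝ) : Prop where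
  memLp : ∀ m, MemLp (φ m) 2 volume
  integral_eq : ∀ m n, ∫ x, φ m x * φ n x = if m = n then 1 else 0

/-! ### Differentiation matrices -/

/-- `D` is a differentiation matrix of `φ`: `φ_m' = ∑ₖ D m k φ_k` for all `m`. -/
def IsDifferentiationMatrix (D : Matrix ℕ ℕ ℝ) (φ : ℕ → ℝ → ℝ) : Prop :=
  ∀ m x, DifferentiableAt ℝ (φ m) x ∧ HasSum (fun k => D m k * φ k x) (deriv (φ m) x)

/-- An infinite matrix that is skew-symmetric, tridiagonal and irreducible (its directed graph, with
an edge `i → j` whenever `D i j ≠ 0`, is strongly connected). -/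
structure IsSkewTridiagonalIrreducible (D : Matrix ℕ ℕ ℝ) : Prop where
  skew : ∀ m n, D m n = -D n m
  tridiagonal : ∀ m n, m + 1 < n ∨ n + 1 < m → D m n = 0
  irreducible : ∀ m n, Relation.ReflTransGen (fun i j => D i j ≠ 0) m n

/-! ### Jacobi polynomials and tanh-Jacobi functions -/

/-- The Jacobi polynomial `P_m^{(α, β)} = (α+1)_m / m! · ₂F₁(-m, m+α+β+1; α+1; (1-t)/2)`, written
without denominators that can vanish:
`∑_{k ≤ m} (α+k+1)_{m-k} (m+α+β+1)_k / (k! (m-k)!) ((t-1)/2)^k`, `(a)_k` the rising factorial. -/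
def jacobiPoly (α β : ℝ) (m : ℕ) : ℝ[X] :=
  ∑ k ∈ Finset.range (m + 1),
    C ((ascPochhammer ℝ (m - k)).eval (α + k + 1) * (ascPochhammer ℝ k).eval (m + α + β + 1)
      / ((k.factorial : ℝ) * ((m - k).factorial : ℝ))) * (C (1 / 2 : ℝ) * (X - 1)) ^ k

/-- `g_m^{(α, β)} = ∫_{-1}^{1} (1-t)^α (1+t)^β P_m^{(α, β)}(t)² dt`. -/
def jacobiNormSq (α β : ℝ) (m : ℕ) : ℝ :=
  ∫ t in Ioo (-1 : ℝ) 1, (1 - t) ^ α * (1 + t) ^ β * ((jacobiPoly α β m).eval t) ^ 2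

/-- The tanh-Jacobi functions. -/
def tanhJacobi (α β : ℝ) (m : ℕ) (x : ℝ) : ℝ :=
  (-1) ^ m / √(jacobiNormSq α β m) * (1 - Real.tanh x) ^ ((α + 1) / 2)
    * (1 + Real.tanh x) ^ ((β + 1) / 2) * (jacobiPoly α β m).eval (Real.tanh x)

/-- The off-diagonal entries
`√((m+1)(α+m+1)(β+m+1)(α+β+m+1) / ((α+β+2m+1)(α+β+2m+3)))`.
For `m = 0` the common factor `α+β+1` (which may vanish) is cancelled. -/
def tanhJacobiCoeff (α β : ℝ) (m : ℕ) : ℝ :=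
  if m = 0 then √((α + 1) * (β + 1) / (α + β + 3))
  else √(((m + 1) * (α + m + 1) * (β + m + 1) * (α + β + m + 1))
    / ((α + β + 2 * m + 1) * (α + β + 2 * m + 3)))

/-- `φ` is, with individual signs `s m = ±1`, the tanh-Jacobi system with parameters
`α, β > -1` after the affine change of variables `x ↦ κ x + c` (the factor `√κ` keeps the `L²`-norm),
and `D` is the tridiagonal matrix with the corresponding entries. If the superdiagonal of `D` is
positive, then the sign is one and the same for all `m`. -/
def IsAffineTanhJacobi (φ : ℕ → ℝ → ℝ) (D : Matrix ℕ ℕ ℝ) : Prop :=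
  ∃ (α β κ c : ℝ) (s : ℕ → ℝ), -1 < α ∧ -1 < β ∧ 0 < κ ∧ (∀ m, s m = 1 ∨ s m = -1) ∧
    (∀ m x, φ m x = s m * (√κ * tanhJacobi α β m (κ * x + c))) ∧
    (∀ m n, D m n =
      if n = m + 1 then s m * s n * (κ * tanhJacobiCoeff α β m)
      else if m = n + 1 then -(s m * s n * (κ * tanhJacobiCoeff α β n))
      else 0) ∧
    ((∀ m, 0 < D m (m + 1)) → ∀ m, s m = s 0)

end

/-!
In the variable `t = tanh (κ x + c)` differentiation of `x ↦ Θ(x) p(t)`, with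
`Θ² = κ (1 - t²) (1 - t)^α (1 + t)^β`, becomes `κ` times the operator
`A p = (1 - t²) p' + ½ (β - α - (α + β + 2) t) p` on polynomials (`jacobiSkewOp`,
`hasDerivAt_tanhFactor_mul_eval`), and the inner product of `L²(ℝ)` becomes that of the Jacobi weight
(`integral_tanhFactor_sq_mul`). Both directions rest on this.

Every tanh-Jacobi system is of the required kind: `A` is skew-symmetric, because `(1 - t²) w p` vanishes
at `±1` for the Jacobi weight `w` (`jacobiIntegral_pearson`), and `A P_m` is an explicit combination of
`P_{m+1}` and `P_{m-1}` (`jacobiSkewOp_jacobiPoly_succ`, a comparison of coefficients in powers of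
`(t - 1) / 2`). Orthogonality comes from the Sturm–Liouville equation (`jacobiPoly_sturmLiouville`).
Skew-symmetry alone then yields the ratio of consecutive norms (`jacobiRaise_mul_jacobiNormSq`), hence
the entries of the matrix for the normalized polynomials.

Conversely, the first two rows of `φ_m' = ∑ₖ D m k φ_k` say that `Θ' = (A + B H) Θ`, so that `Θ` has no
zeros, and then that `H' = w(H)` with a polynomial `w` of degree at most two
(`exists_eq_tanh_of_mapped`). As `H` stays in `(-1, 1)` for all `x` and `w > 0` there, `w` vanishes at
`±1` (`eq_zero_at_one_of_autonomous`), so `w = κ (1 - t²)` and `H` is an affine `tanh`. The equation for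
`Θ` integrates to a product of powers of `1 ± H`, and `Θ ∈ L²` forces `α, β > -1`
(`neg_one_lt_of_memLp_tanhFactor`). Orthonormal polynomials of the Jacobi weight are unique up to signs
(`eq_or_eq_neg_of_orthonormal`), and the matrix is read off row by row (`superdiagonal_eq`).
-/

noncomputable section

/-! ### Two differential identities for the Jacobi polynomials -/

/-- The coefficient of `((t - 1) / 2) ^ k` in `P_m^{(α, β)}`, for `k ≤ m`; it is extended by zero to
`k > m`. -/
def jacobiCoeff (α β : ℝ) (m k : ℕ) : ℝ :=
  if k ≤ m then
    (ascPochhammer ℝ (m - k)).eval (α + k + 1) * (ascPochhammer ℝ k).eval (m + α + β + 1)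
      / ((k.factorial : ℝ) * ((m - k).factorial : ℝ))
  else 0

lemma jacobiCoeff_of_lt (α β : ℝ) {m k : ℕ} (h : m < k) : jacobiCoeff α β m k = 0 :=
  if_neg (by omega)

lemma jacobiCoeff_add (α β : ℝ) (j k : ℕ) :
    jacobiCoeff α β (k + j) k =
      (ascPochhammer ℝ j).eval (α + k + 1) * (ascPochhammer ℝ k).eval (k + j + α + β + 1)
        / ((k.factorial : ℝ) * (j.factorial : ℝ)) := by
  simp [jacobiCoeff]

lemma jacobiPoly_eq_sum (α β : ℝ) {m N : ℕ} (h : m < N) :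
    jacobiPoly α β m =
      ∑ k ∈ Finset.range N, C (jacobiCoeff α β m k) * (C (1 / 2 : ℝ) * (X - 1)) ^ k := by
  rw [jacobiPoly]
  symm
  rw [← Finset.sum_subset (Finset.range_subset_range.2 (show m + 1 ≤ N by omega))]
  · refine Finset.sum_congr rfl fun k hk => ?_
    rw [jacobiCoeff, if_pos (by simpa [Nat.lt_succ_iff] using hk)]
  · intro k _ hk
    rw [jacobiCoeff_of_lt α β (by simpa [Nat.lt_succ_iff] using hk)]
    simp

lemma eval_ascPochhammer_succ_left (n : ℕ) (a : ℝ) :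
    (ascPochhammer ℝ (n + 1)).eval a = a * (ascPochhammer ℝ n).eval (a + 1) := by
  simp [ascPochhammer_succ_left]

/-- The two-term recurrence in `k` that expresses the hypergeometric equation. -/
lemma jacobiCoeff_succ (α β : ℝ) (m k : ℕ) :
    ((k + 1) * (k + 1 + α)) * jacobiCoeff α β m (k + 1) =
      (m * (m + α + β + 1) - k * (k + α + β + 1)) * jacobiCoeff α β m k := by
  rcases lt_trichotomy m k with h | rfl | h
  · simp [jacobiCoeff_of_lt α β h, jacobiCoeff_of_lt α β (Nat.lt_succ_of_lt h)]
  · simp [jacobiCoeff_of_lt α β (Nat.lt_succ_self m)]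
  · obtain ⟨j, rfl⟩ : ∃ j, m = k + 1 + j := ⟨m - (k + 1), by omega⟩
    have e1 : (ascPochhammer ℝ (j + 1)).eval (α + k + 1) =
        (α + k + 1) * (ascPochhammer ℝ j).eval (α + (k + 1 : ℕ) + 1) := by
      rw [eval_ascPochhammer_succ_left]; push_cast; ring_nf
    have e2 : (ascPochhammer ℝ (k + 1)).eval ((k + 1 : ℕ) + (j : ℝ) + α + β + 1) =
        (ascPochhammer ℝ k).eval (k + (j + 1 : ℕ) + α + β + 1) *
          (2 * k + j + α + β + 2) := by
      rw [ascPochhammer_succ_eval]; push_cast; ring_nf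
    rw [jacobiCoeff_add, e2, show k + 1 + j = k + (j + 1) by ring, jacobiCoeff_add, e1]
    have h1 : ((k.factorial : ℕ) : ℝ) ≠ 0 := by positivity
    have h2 : ((j.factorial : ℕ) : ℝ) ≠ 0 := by positivity
    generalize (ascPochhammer ℝ j).eval (α + (k + 1 : ℕ) + 1) = Q
    generalize (ascPochhammer ℝ k).eval (k + (j + 1 : ℕ) + α + β + 1) = R
    simp only [Nat.factorial_succ]
    push_cast
    field_simp
    ring

/-- The polynomial `τ` of the Pearson equation `((1 - t²) w)' = τ w` for the Jacobi weight `w`. -/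
def pearsonPoly (α β : ℝ) : ℝ[X] := C (β - α) - C (α + β + 2) * X

/-- The operator `p ↦ (1 - t²) p' + τ p / 2`. It is `d/dx` in the variable `t = tanh x`, conjugated
by `(1 - t)^((α+1)/2) (1 + t)^((β+1)/2)`, and it is skew-symmetric for the Jacobi weight. -/
def jacobiSkewOp (α β : ℝ) (p : ℝ[X]) : ℝ[X] :=
  (1 - X ^ 2) * derivative p + C (1 / 2 : ℝ) * pearsonPoly α β * p

/-- The Sturm–Liouville equation of the Jacobi polynomials. -/
lemma jacobiPoly_sturmLiouville (α β : ℝ) (m : ℕ) :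
    (1 - X ^ 2) * derivative (derivative (jacobiPoly α β m)) +
        pearsonPoly α β * derivative (jacobiPoly α β m) =
      C (-(m * (m + α + β + 1))) * jacobiPoly α β m := by
  have hmono : ∀ k : ℕ, (1 - X ^ 2) * derivative (derivative ((C (1 / 2 : ℝ) * (X - 1)) ^ (k + 1)))
        + pearsonPoly α β * derivative ((C (1 / 2 : ℝ) * (X - 1)) ^ (k + 1)) =
      C (-((k + 1) * ((k + 1) + α + β + 1))) * (C (1 / 2 : ℝ) * (X - 1)) ^ (k + 1) -
        C ((k + 1) * ((k + 1) + α)) * (C (1 / 2 : ℝ) * (X - 1)) ^ k := by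
    intro k
    have hX : (X : ℝ[X]) = 1 + C 2 * (C (1 / 2 : ℝ) * (X - 1)) := by
      rw [← mul_assoc, ← C_mul]; norm_num
    have hd : derivative (C (1 / 2 : ℝ) * (X - 1)) = C (1 / 2 : ℝ) := by simp
    set y : ℝ[X] := C (1 / 2 : ℝ) * (X - 1) with hy
    rw [pearsonPoly, hX]
    rcases k with _ | k
    · apply Polynomial.funext
      intro t
      simp [hd]
      ring
    · apply Polynomial.funext
      intro t
      simp [derivative_pow, hd]
      ring
  have hzero : (1 - X ^ 2) * derivative (derivative ((C (1 / 2 : ℝ) * (X - 1)) ^ 0))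
        + pearsonPoly α β * derivative ((C (1 / 2 : ℝ) * (X - 1)) ^ 0) = 0 := by
    simp
  rw [jacobiPoly_eq_sum α β (Nat.lt_succ_self m)]
  simp only [derivative_sum, derivative_C_mul, Finset.mul_sum, ← Finset.sum_add_distrib]
  have hsplit : ∀ k ∈ Finset.range (m + 1),
      (1 - X ^ 2) * (C (jacobiCoeff α β m k) *
          derivative (derivative ((C (1 / 2 : ℝ) * (X - 1)) ^ k))) +
        pearsonPoly α β * (C (jacobiCoeff α β m k) *
          derivative ((C (1 / 2 : ℝ) * (X - 1)) ^ k)) =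
      C (jacobiCoeff α β m k) *
        ((1 - X ^ 2) * derivative (derivative ((C (1 / 2 : ℝ) * (X - 1)) ^ k)) +
        pearsonPoly α β * derivative ((C (1 / 2 : ℝ) * (X - 1)) ^ k)) := fun k _ => by ring
  rw [Finset.sum_congr rfl hsplit]
  have hL : ∑ k ∈ Finset.range (m + 1), C (jacobiCoeff α β m k) *
        ((1 - X ^ 2) * derivative (derivative ((C (1 / 2 : ℝ) * (X - 1)) ^ k)) +
        pearsonPoly α β * derivative ((C (1 / 2 : ℝ) * (X - 1)) ^ k)) =
      ∑ k ∈ Finset.range (m + 1),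
          C (-(k * (k + α + β + 1)) * jacobiCoeff α β m k) * (C (1 / 2 : ℝ) * (X - 1)) ^ k -
      ∑ k ∈ Finset.range (m + 1),
          C ((k + 1) * (k + 1 + α) * jacobiCoeff α β m (k + 1)) *
            (C (1 / 2 : ℝ) * (X - 1)) ^ k := by
    rw [Finset.sum_range_succ', hzero, Finset.sum_range_succ' _ m,
      Finset.sum_range_succ (fun k => C (((k : ℝ) + 1) * (k + 1 + α) *
        jacobiCoeff α β m (k + 1)) * (C (1 / 2 : ℝ) * (X - 1)) ^ k) m,
      jacobiCoeff_of_lt α β (Nat.lt_succ_self m)]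
    simp only [hmono, mul_zero, Nat.cast_zero, zero_mul, C_0, add_zero, neg_zero,
      ← Finset.sum_sub_distrib]
    refine Finset.sum_congr rfl fun k _ => ?_
    push_cast
    simp only [C_mul, C_neg]
    ring
  rw [hL, ← Finset.sum_sub_distrib]
  refine Finset.sum_congr rfl fun k _ => ?_
  rw [jacobiCoeff_succ, ← sub_mul, ← C_sub, ← mul_assoc, ← C_mul]
  congr 2
  ring

/-- The factor of `P_{m+1}` in the image of `P_m` under `jacobiSkewOp`. For `m = 0` the common factor
`α + β + 1`, which may vanish, is cancelled. -/
def jacobiRaise (α β : ℝ) (m : ℕ) : ℝ :=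
  if m = 0 then -1 else -((m + 1) * (m + α + β + 1) / (2 * m + α + β + 1))

/-- The factor of `P_{m-1}` in the image of `P_m` under `jacobiSkewOp`, for `m ≥ 1`. -/
def jacobiLower (α β : ℝ) (m : ℕ) : ℝ := (m + α) * (m + β) / (2 * m + α + β + 1)

lemma jacobiSkewOp_pow (α β : ℝ) (k : ℕ) :
    jacobiSkewOp α β ((C (1 / 2 : ℝ) * (X - 1)) ^ k) =
      C (-(2 * k + α + 1)) * (C (1 / 2 : ℝ) * (X - 1)) ^ k +
        C (-(2 * k + α + β + 2)) * (C (1 / 2 : ℝ) * (X - 1)) ^ (k + 1) := by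
  rw [jacobiSkewOp, pearsonPoly]
  rcases k with _ | k
  · apply Polynomial.funext
    intro t
    simp
    ring
  · apply Polynomial.funext
    intro t
    simp [derivative_pow]
    ring

lemma jacobiSkewOp_jacobiPoly_eq_sum (α β : ℝ) (m : ℕ) :
    jacobiSkewOp α β (jacobiPoly α β m) =
      C (-(α + 1) * jacobiCoeff α β m 0) +
      ∑ k ∈ Finset.range (m + 1),
        C (-(2 * k + α + 3) * jacobiCoeff α β m (k + 1) -
          (2 * k + α + β + 2) * jacobiCoeff α β m k) * (C (1 / 2 : ℝ) * (X - 1)) ^ (k + 1) := by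
  have h : jacobiSkewOp α β (jacobiPoly α β m) = ∑ k ∈ Finset.range (m + 1),
      C (jacobiCoeff α β m k) * jacobiSkewOp α β ((C (1 / 2 : ℝ) * (X - 1)) ^ k) := by
    rw [jacobiPoly_eq_sum α β (Nat.lt_succ_self m), jacobiSkewOp]
    simp only [derivative_sum, derivative_C_mul, Finset.mul_sum, ← Finset.sum_add_distrib]
    refine Finset.sum_congr rfl fun k _ => ?_
    rw [jacobiSkewOp]
    ring
  rw [h]
  simp only [jacobiSkewOp_pow, mul_add, Finset.sum_add_distrib]
  rw [Finset.sum_range_succ']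
  have h0 : ∑ k ∈ Finset.range m, C (jacobiCoeff α β m (k + 1)) *
        (C (-(2 * ((k + 1 : ℕ) : ℝ) + α + 1)) * (C (1 / 2 : ℝ) * (X - 1)) ^ (k + 1)) =
      ∑ k ∈ Finset.range (m + 1), C (jacobiCoeff α β m (k + 1)) *
        (C (-(2 * ((k + 1 : ℕ) : ℝ) + α + 1)) * (C (1 / 2 : ℝ) * (X - 1)) ^ (k + 1)) := by
    rw [Finset.sum_range_succ, jacobiCoeff_of_lt α β (Nat.lt_succ_self m)]
    simp
  rw [h0, add_right_comm, ← Finset.sum_add_distrib, add_comm]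
  congr 1
  · simp [mul_comm]
  · refine Finset.sum_congr rfl fun k _ => ?_
    rw [← mul_assoc, ← mul_assoc, ← add_mul, ← C_mul, ← C_mul, ← C_add]
    congr 2
    push_cast
    ring

lemma jacobiSkewOp_jacobiPoly_zero (α β : ℝ) :
    jacobiSkewOp α β (jacobiPoly α β 0) = C (jacobiRaise α β 0) * jacobiPoly α β 1 := by
  rw [jacobiPoly, jacobiPoly, jacobiSkewOp, pearsonPoly]
  apply Polynomial.funext
  intro t
  simp [Finset.sum_range_succ, jacobiRaise]
  ring

/-- The coefficientwise form of `jacobiSkewOp_jacobiPoly_succ`, in the powers `k ≥ 1`. -/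
lemma jacobiCoeff_contiguous {α β : ℝ} (hα : -1 < α) (hβ : -1 < β) (m k : ℕ) (hk : k < m + 2) :
    -(2 * k + α + 3) * jacobiCoeff α β (m + 1) (k + 1) -
          (2 * k + α + β + 2) * jacobiCoeff α β (m + 1) k =
      jacobiRaise α β (m + 1) * jacobiCoeff α β (m + 2) (k + 1) +
        jacobiLower α β (m + 1) * jacobiCoeff α β m (k + 1) := by
  have hm : (0 : ℝ) ≤ m := Nat.cast_nonneg m
  have hk0 : (0 : ℝ) ≤ k := Nat.cast_nonneg k
  have hk1 : ((k.factorial : ℕ) : ℝ) ≠ 0 := by positivity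
  rw [jacobiRaise, if_neg (Nat.succ_ne_zero m), jacobiLower]
  push_cast
  have hden : 2 * ((m : ℝ) + 1) + α + β + 1 ≠ 0 := by linarith
  rcases lt_trichotomy k m with h | rfl | h
  · obtain ⟨j, rfl⟩ : ∃ j, m = k + 1 + j := ⟨m - (k + 1), by omega⟩
    rw [jacobiCoeff_add, show k + 1 + j + 1 = k + 1 + (j + 1) by ring, jacobiCoeff_add,
      show k + 1 + (j + 1) = k + (j + 2) by ring, jacobiCoeff_add,
      show k + 1 + j + 2 = k + 1 + (j + 2) by ring, jacobiCoeff_add]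
    have e1 : (ascPochhammer ℝ (j + 1)).eval (α + (k + 1 : ℕ) + 1) =
        (ascPochhammer ℝ j).eval (α + k + 2) * (α + k + 2 + j) := by
      rw [ascPochhammer_succ_eval]; push_cast; ring_nf
    have e2 : (ascPochhammer ℝ (j + 2)).eval (α + (k + 1 : ℕ) + 1) =
        (ascPochhammer ℝ j).eval (α + k + 2) * (α + k + 2 + j) * (α + k + 3 + j) := by
      rw [ascPochhammer_succ_eval, ascPochhammer_succ_eval]; push_cast; ring_nf
    have e3 : (ascPochhammer ℝ (j + 2)).eval (α + k + 1) =
        (α + k + 1) * (ascPochhammer ℝ j).eval (α + k + 2) * (α + k + 2 + j) := by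
      rw [eval_ascPochhammer_succ_left, ascPochhammer_succ_eval]; ring_nf
    have e4 : (ascPochhammer ℝ j).eval (α + (k + 1 : ℕ) + 1) =
        (ascPochhammer ℝ j).eval (α + k + 2) := by
      congr 1; push_cast; ring
    set Q := (ascPochhammer ℝ j).eval (α + k + 2)
    rw [e1, e2, e3, e4]
    have f1 : (ascPochhammer ℝ (k + 1)).eval ((k + 1 : ℕ) + (j + 1 : ℕ) + α + β + 1) =
        (ascPochhammer ℝ k).eval (k + j + α + β + 3) * (2 * k + j + α + β + 3) := by
      rw [ascPochhammer_succ_eval]; push_cast; ring_nf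
    have f2 : (ascPochhammer ℝ k).eval ((k : ℝ) + (j + 2 : ℕ) + α + β + 1) =
        (ascPochhammer ℝ k).eval (k + j + α + β + 3) := by
      congr 1; push_cast; ring
    have f3 : (k + j + α + β + 3) *
        (ascPochhammer ℝ (k + 1)).eval ((k + 1 : ℕ) + (j + 2 : ℕ) + α + β + 1) =
        (ascPochhammer ℝ k).eval (k + j + α + β + 3) * (2 * k + j + α + β + 3) *
          (2 * k + j + α + β + 4) := by
      have := eval_ascPochhammer_succ_left (k + 1) (k + j + α + β + 3)
      rw [show k + 1 + 1 = k + 2 by ring, ascPochhammer_succ_eval, ascPochhammer_succ_eval] at this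
      rw [show ((k + 1 : ℕ) : ℝ) + (j + 2 : ℕ) + α + β + 1 = k + j + α + β + 3 + 1 by
        push_cast; ring, ← this]
      push_cast; ring
    have f4 : (ascPochhammer ℝ (k + 1)).eval ((k + 1 : ℕ) + (j : ℝ) + α + β + 1) =
        (k + j + α + β + 2) * (ascPochhammer ℝ k).eval (k + j + α + β + 3) := by
      rw [eval_ascPochhammer_succ_left]; push_cast; ring_nf
    rw [f1, f2, f4]
    rw [show ∀ A B F c : ℝ, -((((k + 1 + j : ℕ) : ℝ) + 1 + 1) *
      (((k + 1 + j : ℕ) : ℝ) + 1 + α + β + 1) / A) * (B * F / c) =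
      -((((k + 1 + j : ℕ) : ℝ) + 1 + 1) / A * (B * ((k + j + α + β + 3) * F) / c)) by
        intro A B F c; push_cast; ring, f3]
    set R := (ascPochhammer ℝ k).eval (k + j + α + β + 3)
    have hj1 : ((j.factorial : ℕ) : ℝ) ≠ 0 := by positivity
    simp only [Nat.factorial_succ]
    push_cast at hden ⊢
    field_simp
    ring
  · have f1 : jacobiCoeff α β (k + 1) (k + 1) =
        (ascPochhammer ℝ k).eval (k + α + β + 2) * (2 * k + α + β + 2) / (k + 1).factorial := by
      have := jacobiCoeff_add α β 0 (k + 1)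
      rw [add_zero, ascPochhammer_succ_eval] at this
      rw [this]
      simp
      ring_nf
    have f2 : jacobiCoeff α β (k + 1) k =
        (α + k + 1) * (ascPochhammer ℝ k).eval (k + α + β + 2) / k.factorial := by
      rw [jacobiCoeff_add]
      simp
      ring_nf
    have f3 : (k + α + β + 2) * jacobiCoeff α β (k + 2) (k + 1) = (α + k + 2) *
        ((ascPochhammer ℝ k).eval (k + α + β + 2) * (2 * k + α + β + 2) * (2 * k + α + β + 3)) /
          (k + 1).factorial := by
      have := eval_ascPochhammer_succ_left (k + 1) (k + α + β + 2)
      rw [show k + 1 + 1 = k + 2 by ring, ascPochhammer_succ_eval, ascPochhammer_succ_eval] at this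
      have h2 := jacobiCoeff_add α β 1 (k + 1)
      rw [show ((k + 1 : ℕ) : ℝ) + (1 : ℕ) + α + β + 1 = k + α + β + 2 + 1 by push_cast; ring] at h2
      rw [show k + 2 = k + 1 + 1 by ring, h2, mul_div_assoc', mul_left_comm, ← this]
      simp
      ring_nf
    rw [f1, f2, jacobiCoeff_of_lt α β (Nat.lt_succ_self k),
      show -(((k : ℝ) + 1 + 1) * (k + 1 + α + β + 1) / (2 * (k + 1) + α + β + 1)) *
        jacobiCoeff α β (k + 2) (k + 1) = -((k : ℝ) + 1 + 1) / (2 * (k + 1) + α + β + 1) *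
          ((k + α + β + 2) * jacobiCoeff α β (k + 2) (k + 1)) by ring, f3, Nat.factorial_succ]
    push_cast
    field_simp
    ring
  · obtain rfl : k = m + 1 := by omega
    have f1 : jacobiCoeff α β (m + 1) (m + 1) =
        (ascPochhammer ℝ m).eval (m + α + β + 2) * (2 * m + α + β + 2) / (m + 1).factorial := by
      have := jacobiCoeff_add α β 0 (m + 1)
      rw [add_zero, ascPochhammer_succ_eval] at this
      rw [this]
      simp
      ring_nf
    have f2 : (m + α + β + 2) * jacobiCoeff α β (m + 2) (m + 2) =
        (ascPochhammer ℝ m).eval (m + α + β + 2) * (2 * m + α + β + 2) * (2 * m + α + β + 3) *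
          (2 * m + α + β + 4) / (m + 2).factorial := by
      have := eval_ascPochhammer_succ_left (m + 2) (m + α + β + 2)
      rw [ascPochhammer_succ_eval, ascPochhammer_succ_eval, ascPochhammer_succ_eval] at this
      have h2 := jacobiCoeff_add α β 0 (m + 2)
      rw [show ((m + 2 : ℕ) : ℝ) + (0 : ℕ) + α + β + 1 = m + α + β + 2 + 1 by push_cast; ring,
        add_zero] at h2
      rw [h2, mul_div_assoc', mul_left_comm, ← this]
      simp
      ring_nf
    rw [f1, show m + 1 + 1 = m + 2 by ring, jacobiCoeff_of_lt α β (show m + 1 < m + 2 by omega),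
      jacobiCoeff_of_lt α β (show m < m + 2 by omega),
      show -(((m : ℝ) + 1 + 1) * (m + 1 + α + β + 1) / (2 * (m + 1) + α + β + 1)) *
        jacobiCoeff α β (m + 2) (m + 2) = -((m : ℝ) + 1 + 1) / (2 * (m + 1) + α + β + 1) *
          ((m + α + β + 2) * jacobiCoeff α β (m + 2) (m + 2)) by ring, f2]
    simp only [Nat.factorial_succ]
    push_cast
    have : ((m.factorial : ℕ) : ℝ) ≠ 0 := by positivity
    field_simp
    ring

lemma jacobiCoeff_contiguous_zero {α β : ℝ} (hα : -1 < α) (hβ : -1 < β) (m : ℕ) :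
    -(α + 1) * jacobiCoeff α β (m + 1) 0 =
      jacobiRaise α β (m + 1) * jacobiCoeff α β (m + 2) 0 +
        jacobiLower α β (m + 1) * jacobiCoeff α β m 0 := by
  have hm : (0 : ℝ) ≤ m := Nat.cast_nonneg m
  have hden : ((m : ℝ) + 1) * 2 + α + β + 1 ≠ 0 := by linarith
  have h : ∀ n, jacobiCoeff α β n 0 = (ascPochhammer ℝ n).eval (α + 1) / n.factorial := by
    intro n
    have := jacobiCoeff_add α β n 0
    simpa using this
  rw [jacobiRaise, if_neg (Nat.succ_ne_zero m), jacobiLower, h, h, h, ascPochhammer_succ_eval,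
    ascPochhammer_succ_eval, ascPochhammer_succ_eval]
  simp only [Nat.factorial_succ]
  have : ((m.factorial : ℕ) : ℝ) ≠ 0 := by positivity
  generalize (ascPochhammer ℝ m).eval (α + 1) = Q
  push_cast
  field_simp
  ring

/-- The skew-symmetric operator is tridiagonal, with zero diagonal, on the Jacobi polynomials. -/
lemma jacobiSkewOp_jacobiPoly_succ {α β : ℝ} (hα : -1 < α) (hβ : -1 < β) (m : ℕ) :
    jacobiSkewOp α β (jacobiPoly α β (m + 1)) =
      C (jacobiRaise α β (m + 1)) * jacobiPoly α β (m + 2) +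
        C (jacobiLower α β (m + 1)) * jacobiPoly α β m := by
  rw [jacobiSkewOp_jacobiPoly_eq_sum, jacobiPoly_eq_sum α β (show m + 2 < m + 3 by omega),
    jacobiPoly_eq_sum α β (show m < m + 3 by omega), Finset.sum_range_succ' _ (m + 2),
    Finset.sum_range_succ' _ (m + 2), jacobiCoeff_contiguous_zero hα hβ]
  simp only [pow_zero, mul_one, mul_add, Finset.mul_sum]
  rw [add_add_add_comm, ← Finset.sum_add_distrib, ← C_mul, ← C_mul, ← C_add, add_comm]
  congr 1
  refine Finset.sum_congr rfl fun k hk => ?_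
  rw [jacobiCoeff_contiguous hα hβ m k (Finset.mem_range.1 hk), ← mul_assoc, ← mul_assoc, ← add_mul,
    ← C_mul, ← C_mul, ← C_add]

lemma jacobiRaise_neg {α β : ℝ} (hα : -1 < α) (hβ : -1 < β) (m : ℕ) :
    jacobiRaise α β m < 0 := by
  rw [jacobiRaise]
  rcases m with _ | m
  · simp
  · rw [if_neg (Nat.succ_ne_zero m), neg_lt_zero]
    have hm : (0 : ℝ) ≤ m := Nat.cast_nonneg m
    push_cast
    exact div_pos (mul_pos (by linarith) (by linarith)) (by linarith)

lemma jacobiLower_succ_pos {α β : ℝ} (hα : -1 < α) (hβ : -1 < β) (m : ℕ) :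
    0 < jacobiLower α β (m + 1) := by
  have hm : (0 : ℝ) ≤ m := Nat.cast_nonneg m
  rw [jacobiLower]
  push_cast
  exact div_pos (mul_pos (by linarith) (by linarith)) (by linarith)

lemma tanhJacobiCoeff_eq_sqrt (α β : ℝ) (m : ℕ) :
    tanhJacobiCoeff α β m = √(-jacobiRaise α β m * jacobiLower α β (m + 1)) := by
  rw [tanhJacobiCoeff, jacobiRaise, jacobiLower]
  rcases m with _ | m
  · simp
    ring_nf
  · rw [if_neg (Nat.succ_ne_zero m), if_neg (Nat.succ_ne_zero m)]
    push_cast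
    congr 1
    rw [neg_neg, div_mul_div_comm]
    congr 1 <;> ring

lemma tanhJacobiCoeff_pos {α β : ℝ} (hα : -1 < α) (hβ : -1 < β) (m : ℕ) :
    0 < tanhJacobiCoeff α β m := by
  rw [tanhJacobiCoeff_eq_sqrt]
  exact Real.sqrt_pos.2 (mul_pos (neg_pos.2 (jacobiRaise_neg hα hβ m)) (jacobiLower_succ_pos hα hβ m))

lemma degree_jacobiPoly {α β : ℝ} (hα : -1 < α) (hβ : -1 < β) (m : ℕ) :
    (jacobiPoly α β m).degree = (m : WithBot ℕ) := by
  have hdeg : ∀ (k : ℕ) (a : ℝ),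
      (C a * (C (1 / 2 : ℝ) * (X - 1)) ^ k).degree ≤ (k : WithBot ℕ) := by
    intro k a
    refine degree_le_of_natDegree_le ?_
    compute_degree
  have hlead : jacobiCoeff α β m m ≠ 0 := by
    have h := jacobiCoeff_add α β 0 m
    rw [add_zero] at h
    rw [h]
    simp only [ascPochhammer_zero, eval_one, one_mul, Nat.factorial_zero, Nat.cast_one, mul_one,
      CharP.cast_eq_zero, add_zero]
    rcases m with _ | m
    · simp
    · have hm : (0 : ℝ) ≤ m := Nat.cast_nonneg m
      exact (div_pos (ascPochhammer_pos _ _ (by push_cast; linarith)) (by positivity)).ne'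
  rw [jacobiPoly_eq_sum α β (Nat.lt_succ_self m), Finset.sum_range_succ]
  have htop : (C (jacobiCoeff α β m m) * (C (1 / 2 : ℝ) * (X - 1)) ^ m).degree
      = (m : WithBot ℕ) := by
    have h1 : (X - 1 : ℝ[X]).degree = 1 := by simpa using degree_X_sub_C (1 : ℝ)
    have h2 : (C (1 / 2 : ℝ)).degree = 0 := degree_C (by norm_num)
    rw [degree_mul, degree_pow, degree_mul, degree_C hlead, h1, h2]
    simp
  rw [degree_add_eq_right_of_degree_lt, htop]
  rw [htop]
  rw [← mem_degreeLT]
  refine Submodule.sum_mem _ fun k hk => mem_degreeLT.2 ?_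
  exact lt_of_le_of_lt (hdeg k _) (by exact_mod_cast Finset.mem_range.1 hk)

/-! ### The Jacobi weight and orthogonality -/

/-- The Jacobi weight `(1 - t)^α (1 + t)^β`. -/
def jacobiWeight (α β t : ℝ) : ℝ := (1 - t) ^ α * (1 + t) ^ β

/-- Integration of polynomials against the Jacobi weight on `(-1, 1)`. -/
def jacobiIntegral (α β : ℝ) (p : ℝ[X]) : ℝ :=
  ∫ t in Ioo (-1 : ℝ) 1, jacobiWeight α β t * p.eval t

lemma jacobiWeight_pos (α β : ℝ) {t : ℝ} (ht : t ∈ Ioo (-1 : ℝ) 1) : 0 < jacobiWeight α β t :=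
  mul_pos (Real.rpow_pos_of_pos (by linarith [ht.2]) _) (Real.rpow_pos_of_pos (by linarith [ht.1]) _)

lemma integrableOn_jacobiWeight {α β : ℝ} (hα : -1 < α) (hβ : -1 < β) :
    IntegrableOn (jacobiWeight α β) (Ioo (-1 : ℝ) 1) := by
  have hleft : IntervalIntegrable (jacobiWeight α β) volume (-1) 0 := by
    have h1 : IntervalIntegrable (fun t : ℝ => (1 + t) ^ β) volume (-1) 0 := by
      have := (intervalIntegral.intervalIntegrable_rpow' (a := 0) (b := 1) hβ).comp_add_left 1
      norm_num at this
      exact this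
    refine (h1.mul_continuousOn (g := fun t : ℝ => (1 - t) ^ α) ?_).congr
      (fun t _ => mul_comm _ _)
    intro t ht
    rw [uIcc_of_le (by norm_num)] at ht
    exact ((continuousAt_const.sub continuousAt_id).rpow_const
      (Or.inl (show (1 : ℝ) - t ≠ 0 by linarith [ht.2]))).continuousWithinAt
  have hright : IntervalIntegrable (jacobiWeight α β) volume 0 1 := by
    have h1 : IntervalIntegrable (fun t : ℝ => (1 - t) ^ α) volume 0 1 := by
      have := (intervalIntegral.intervalIntegrable_rpow' (a := 0) (b := 1) hα).comp_sub_left 1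
      norm_num at this
      exact this.symm
    refine h1.mul_continuousOn (g := fun t : ℝ => (1 + t) ^ β) ?_
    intro t ht
    rw [uIcc_of_le (by norm_num)] at ht
    exact ((continuousAt_const.add continuousAt_id).rpow_const
      (Or.inl (show (1 : ℝ) + t ≠ 0 by linarith [ht.1]))).continuousWithinAt
  have h := (intervalIntegrable_iff_integrableOn_Ioo_of_le (by norm_num)).1 (hleft.trans hright)
  exact h

lemma integrableOn_jacobiWeight_mul {α β : ℝ} (hα : -1 < α) (hβ : -1 < β) (p : ℝ[X]) :
    IntegrableOn (fun t => jacobiWeight α β t * p.eval t) (Ioo (-1 : ℝ) 1) := by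
  obtain ⟨M, hM⟩ := (isCompact_Icc (a := (-1 : ℝ)) (b := 1)).exists_bound_of_continuousOn
    p.continuous.continuousOn
  refine (integrableOn_jacobiWeight hα hβ).mul_bdd (c := M) p.continuous.aestronglyMeasurable ?_
  filter_upwards [ae_restrict_mem measurableSet_Ioo] with t ht
  exact hM t (Ioo_subset_Icc_self ht)

lemma jacobiIntegral_add {α β : ℝ} (hα : -1 < α) (hβ : -1 < β) (p q : ℝ[X]) :
    jacobiIntegral α β (p + q) = jacobiIntegral α β p + jacobiIntegral α β q := by
  simp only [jacobiIntegral, eval_add, mul_add]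
  exact integral_add (integrableOn_jacobiWeight_mul hα hβ p) (integrableOn_jacobiWeight_mul hα hβ q)

lemma jacobiIntegral_C_mul (α β a : ℝ) (p : ℝ[X]) :
    jacobiIntegral α β (C a * p) = a * jacobiIntegral α β p := by
  simp only [jacobiIntegral, eval_mul, eval_C, mul_left_comm _ a]
  exact integral_const_mul _ _

/-- Pearson's equation in integrated form: `(1 - t²) w p` vanishes at `±1`, so that its derivative
`((1 - t²) p' + τ p) w` has integral zero. -/
lemma jacobiIntegral_pearson {α β : ℝ} (hα : -1 < α) (hβ : -1 < β) (p : ℝ[X]) :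
    jacobiIntegral α β ((1 - X ^ 2) * derivative p + pearsonPoly α β * p) = 0 := by
  set r : ℝ[X] := (1 - X ^ 2) * derivative p + pearsonPoly α β * p with hr
  have hint : IntervalIntegrable (fun t => jacobiWeight α β t * r.eval t) volume (-1) 1 :=
    (intervalIntegrable_iff_integrableOn_Ioo_of_le (by norm_num)).2
      (integrableOn_jacobiWeight_mul hα hβ r)
  have h := intervalIntegral.integral_eq_sub_of_hasDerivAt_of_le (a := (-1 : ℝ)) (b := 1)
    (f := fun t => (1 - t) ^ (α + 1) * (1 + t) ^ (β + 1) * p.eval t) (by norm_num) ?_ ?_ hint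
  · rw [intervalIntegral.integral_of_le (by norm_num), integral_Ioc_eq_integral_Ioo] at h
    rw [jacobiIntegral, h]
    have h1 : α + 1 ≠ 0 := by linarith
    have h2 : β + 1 ≠ 0 := by linarith
    simp [Real.zero_rpow h1, Real.zero_rpow h2]
  · refine Continuous.continuousOn ?_
    refine (Continuous.mul ?_ ?_).mul p.continuous
    · exact (continuous_const.sub continuous_id).rpow_const fun t => Or.inr (by linarith)
    · exact (continuous_const.add continuous_id).rpow_const fun t => Or.inr (by linarith)
  · intro t ht
    have h1 : 0 < 1 - t := by linarith [ht.2]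
    have h2 : 0 < 1 + t := by linarith [ht.1]
    have d1 := ((hasDerivAt_id t).const_sub 1).rpow_const (p := α + 1) (Or.inl h1.ne')
    have d2 := ((hasDerivAt_id t).const_add 1).rpow_const (p := β + 1) (Or.inl h2.ne')
    refine ((d1.mul d2).mul (p.hasDerivAt t)).congr_deriv ?_
    simp only [id, add_sub_cancel_right, Pi.mul_apply]
    rw [Real.rpow_add_one h1.ne', Real.rpow_add_one h2.ne', hr, jacobiWeight, pearsonPoly]
    simp
    ring

lemma jacobiIntegral_skewOp_mul {α β : ℝ} (hα : -1 < α) (hβ : -1 < β) (p q : ℝ[X]) :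
    jacobiIntegral α β (jacobiSkewOp α β p * q) =
      -jacobiIntegral α β (p * jacobiSkewOp α β q) := by
  have h := jacobiIntegral_pearson hα hβ (p * q)
  have hC : (C (1 / 2 : ℝ) : ℝ[X]) * 2 = 1 := by
    rw [← C_ofNat, ← C_mul]; norm_num
  rw [eq_neg_iff_add_eq_zero, ← jacobiIntegral_add hα hβ, ← h]
  congr 1
  rw [jacobiSkewOp, jacobiSkewOp, derivative_mul]
  linear_combination (pearsonPoly α β * p * q) * hC

/-- Eigenfunctions of the Sturm–Liouville operator with distinct eigenvalues are orthogonal. -/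
lemma jacobiIntegral_mul_eq_zero {α β : ℝ} (hα : -1 < α) (hβ : -1 < β) {m n : ℕ} (hmn : m ≠ n) :
    jacobiIntegral α β (jacobiPoly α β m * jacobiPoly α β n) = 0 := by
  have hm := jacobiPoly_sturmLiouville α β m
  have hn := jacobiPoly_sturmLiouville α β n
  set p := jacobiPoly α β m
  set q := jacobiPoly α β n
  have h := jacobiIntegral_pearson hα hβ (derivative p * q - p * derivative q)
  have hw : (1 - X ^ 2) * derivative (derivative p * q - p * derivative q) +
      pearsonPoly α β * (derivative p * q - p * derivative q) =
      C (-(m * (m + α + β + 1)) - -(n * (n + α + β + 1))) * (p * q) := by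
    rw [derivative_sub, derivative_mul, derivative_mul, C_sub]
    linear_combination q * hm - p * hn
  rw [hw, jacobiIntegral_C_mul] at h
  refine (mul_eq_zero.1 h).resolve_left ?_
  rw [show -((m : ℝ) * (m + α + β + 1)) - -(n * (n + α + β + 1)) =
    (n - m) * (m + n + α + β + 1) by ring]
  have h1 : ((n : ℝ) - m) ≠ 0 := sub_ne_zero.2 (by exact_mod_cast hmn.symm)
  have h2 : (1 : ℝ) ≤ m + n := by
    have : 1 ≤ m + n := by omega
    exact_mod_cast this
  exact mul_ne_zero h1 (by linarith)

lemma jacobiIntegral_mul_self_pos {α β : ℝ} (hα : -1 < α) (hβ : -1 < β) {p : ℝ[X]} (hp : p ≠ 0) :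
    0 < jacobiIntegral α β (p * p) := by
  have hnn : ∀ t ∈ Ioo (-1 : ℝ) 1, 0 ≤ jacobiWeight α β t * (p * p).eval t := fun t ht =>
    mul_nonneg (jacobiWeight_pos α β ht).le (by rw [eval_mul]; exact mul_self_nonneg _)
  refine lt_of_le_of_ne (setIntegral_nonneg measurableSet_Ioo hnn) fun h => ?_
  have h0 := (setIntegral_eq_zero_iff_of_nonneg_ae
    ((ae_restrict_iff' measurableSet_Ioo).2 (Filter.Eventually.of_forall hnn))
    (integrableOn_jacobiWeight_mul hα hβ (p * p))).1 h.symm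
  have hroots : ∀ᵐ t ∂volume.restrict (Ioo (-1 : ℝ) 1), p.eval t ≠ 0 := by
    refine ae_restrict_of_ae ?_
    have : {t : ℝ | ¬ p.eval t ≠ 0} = {t | p.IsRoot t} := by ext; simp [IsRoot]
    rw [ae_iff, this]
    exact (finite_setOfPred_isRoot hp).measure_zero _
  have hF : ∀ᵐ t ∂volume.restrict (Ioo (-1 : ℝ) 1), False := by
    filter_upwards [h0, hroots, ae_restrict_mem measurableSet_Ioo] with t h1 h2 h3
    rw [Pi.zero_apply, eval_mul] at h1
    exact mul_ne_zero (jacobiWeight_pos α β h3).ne' (mul_ne_zero h2 h2) h1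
  rw [ae_iff] at hF
  norm_num at hF

lemma jacobiNormSq_eq (α β : ℝ) (m : ℕ) :
    jacobiNormSq α β m = jacobiIntegral α β (jacobiPoly α β m * jacobiPoly α β m) := by
  simp only [jacobiNormSq, jacobiIntegral, jacobiWeight, eval_mul, sq]

lemma jacobiPoly_ne_zero {α β : ℝ} (hα : -1 < α) (hβ : -1 < β) (m : ℕ) : jacobiPoly α β m ≠ 0 := by
  intro h
  have := degree_jacobiPoly hα hβ m
  simp [h] at this

lemma jacobiNormSq_pos {α β : ℝ} (hα : -1 < α) (hβ : -1 < β) (m : ℕ) : 0 < jacobiNormSq α β m := by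
  rw [jacobiNormSq_eq]
  exact jacobiIntegral_mul_self_pos hα hβ (jacobiPoly_ne_zero hα hβ m)

/-- The ratio of consecutive norms, read off from the skew-symmetry of `jacobiSkewOp`; the closed form
of `jacobiNormSq` in terms of Gamma functions is not needed. -/
lemma jacobiRaise_mul_jacobiNormSq {α β : ℝ} (hα : -1 < α) (hβ : -1 < β) (m : ℕ) :
    -jacobiRaise α β m * jacobiNormSq α β (m + 1) =
      jacobiLower α β (m + 1) * jacobiNormSq α β m := by
  have h := jacobiIntegral_skewOp_mul hα hβ (jacobiPoly α β m) (jacobiPoly α β (m + 1))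
  have hL : jacobiIntegral α β (jacobiSkewOp α β (jacobiPoly α β m) * jacobiPoly α β (m + 1)) =
      jacobiRaise α β m * jacobiNormSq α β (m + 1) := by
    rw [jacobiNormSq_eq]
    rcases m with _ | m
    · rw [jacobiSkewOp_jacobiPoly_zero, mul_assoc, jacobiIntegral_C_mul]
    · rw [jacobiSkewOp_jacobiPoly_succ hα hβ, add_mul, mul_assoc, mul_assoc,
        jacobiIntegral_add hα hβ, jacobiIntegral_C_mul, jacobiIntegral_C_mul,
        jacobiIntegral_mul_eq_zero hα hβ (show m ≠ m + 1 + 1 by omega), mul_zero, add_zero]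
  have hR : jacobiIntegral α β (jacobiPoly α β m * jacobiSkewOp α β (jacobiPoly α β (m + 1))) =
      jacobiLower α β (m + 1) * jacobiNormSq α β m := by
    rw [jacobiNormSq_eq, jacobiSkewOp_jacobiPoly_succ hα hβ, mul_add, mul_left_comm,
      mul_left_comm _ (C (jacobiLower α β (m + 1))),
      jacobiIntegral_add hα hβ, jacobiIntegral_C_mul, jacobiIntegral_C_mul,
      jacobiIntegral_mul_eq_zero hα hβ (show m ≠ m + 2 by omega), mul_zero, zero_add]
  rw [hL, hR] at h
  linarith

/-- The orthonormal Jacobi polynomials, with the sign `(-1)^m` of the tanh-Jacobi functions. -/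
def jacobiOrthonormal (α β : ℝ) (m : ℕ) : ℝ[X] :=
  C ((-1) ^ m / √(jacobiNormSq α β m)) * jacobiPoly α β m

lemma degree_jacobiOrthonormal {α β : ℝ} (hα : -1 < α) (hβ : -1 < β) (m : ℕ) :
    (jacobiOrthonormal α β m).degree = (m : WithBot ℕ) := by
  have h : (-1 : ℝ) ^ m / √(jacobiNormSq α β m) ≠ 0 :=
    div_ne_zero (pow_ne_zero _ (by norm_num)) (Real.sqrt_pos.2 (jacobiNormSq_pos hα hβ m)).ne'
  rw [jacobiOrthonormal, degree_C_mul h, degree_jacobiPoly hα hβ]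

lemma jacobiIntegral_jacobiOrthonormal {α β : ℝ} (hα : -1 < α) (hβ : -1 < β) (m n : ℕ) :
    jacobiIntegral α β (jacobiOrthonormal α β m * jacobiOrthonormal α β n) =
      if m = n then 1 else 0 := by
  rw [jacobiOrthonormal, jacobiOrthonormal, mul_assoc, mul_left_comm (jacobiPoly α β m),
    jacobiIntegral_C_mul, jacobiIntegral_C_mul]
  split_ifs with h
  · subst h
    have hg := jacobiNormSq_pos hα hβ m
    have hs : √(jacobiNormSq α β m) ≠ 0 := (Real.sqrt_pos.2 hg).ne'
    rw [← jacobiNormSq_eq]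
    field_simp
    rw [Real.sq_sqrt hg.le, ← pow_mul, mul_comm m 2, pow_mul]
    simp
  · rw [jacobiIntegral_mul_eq_zero hα hβ h]
    simp

lemma neg_jacobiRaise_mul_sqrt {α β : ℝ} (hα : -1 < α) (hβ : -1 < β) (m : ℕ) :
    -jacobiRaise α β m * √(jacobiNormSq α β (m + 1)) =
      tanhJacobiCoeff α β m * √(jacobiNormSq α β m) := by
  have h := jacobiRaise_mul_jacobiNormSq hα hβ m
  have he := neg_pos.2 (jacobiRaise_neg hα hβ m)
  rw [tanhJacobiCoeff_eq_sqrt, ← Real.sqrt_mul (mul_nonneg he.le (jacobiLower_succ_pos hα hβ m).le),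
    mul_assoc, ← h, ← mul_assoc, Real.sqrt_mul (mul_self_nonneg _), Real.sqrt_mul_self he.le]

lemma jacobiLower_mul_sqrt {α β : ℝ} (hα : -1 < α) (hβ : -1 < β) (m : ℕ) :
    jacobiLower α β (m + 1) * √(jacobiNormSq α β m) =
      tanhJacobiCoeff α β m * √(jacobiNormSq α β (m + 1)) := by
  have h := jacobiRaise_mul_jacobiNormSq hα hβ m
  have he := neg_pos.2 (jacobiRaise_neg hα hβ m)
  have hf := jacobiLower_succ_pos hα hβ m
  rw [tanhJacobiCoeff_eq_sqrt, ← Real.sqrt_mul (mul_nonneg he.le hf.le), mul_right_comm, h,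
    mul_right_comm, Real.sqrt_mul (mul_self_nonneg _), Real.sqrt_mul_self hf.le]

lemma jacobiSkewOp_C_mul (α β a : ℝ) (p : ℝ[X]) :
    jacobiSkewOp α β (C a * p) = C a * jacobiSkewOp α β p := by
  rw [jacobiSkewOp, jacobiSkewOp, derivative_C_mul]
  ring

lemma sign_div_sqrt_mul_jacobiRaise {α β : ℝ} (hα : -1 < α) (hβ : -1 < β) (m : ℕ) :
    (-1) ^ m / √(jacobiNormSq α β m) * jacobiRaise α β m =
      tanhJacobiCoeff α β m * ((-1) ^ (m + 1) / √(jacobiNormSq α β (m + 1))) := by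
  have h := neg_jacobiRaise_mul_sqrt hα hβ m
  have h1 : √(jacobiNormSq α β m) ≠ 0 := (Real.sqrt_pos.2 (jacobiNormSq_pos hα hβ m)).ne'
  have h2 : √(jacobiNormSq α β (m + 1)) ≠ 0 :=
    (Real.sqrt_pos.2 (jacobiNormSq_pos hα hβ (m + 1))).ne'
  rw [pow_succ]
  field_simp
  linear_combination -h

lemma sign_div_sqrt_mul_jacobiLower {α β : ℝ} (hα : -1 < α) (hβ : -1 < β) (m : ℕ) :
    (-1) ^ (m + 1) / √(jacobiNormSq α β (m + 1)) * jacobiLower α β (m + 1) =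
      -tanhJacobiCoeff α β m * ((-1) ^ m / √(jacobiNormSq α β m)) := by
  have h := jacobiLower_mul_sqrt hα hβ m
  have h1 : √(jacobiNormSq α β m) ≠ 0 := (Real.sqrt_pos.2 (jacobiNormSq_pos hα hβ m)).ne'
  have h2 : √(jacobiNormSq α β (m + 1)) ≠ 0 :=
    (Real.sqrt_pos.2 (jacobiNormSq_pos hα hβ (m + 1))).ne'
  rw [pow_succ]
  field_simp
  linear_combination -h

lemma jacobiSkewOp_jacobiOrthonormal_zero {α β : ℝ} (hα : -1 < α) (hβ : -1 < β) :
    jacobiSkewOp α β (jacobiOrthonormal α β 0) =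
      C (tanhJacobiCoeff α β 0) * jacobiOrthonormal α β 1 := by
  rw [jacobiOrthonormal, jacobiSkewOp_C_mul, jacobiSkewOp_jacobiPoly_zero, ← mul_assoc, ← C_mul,
    sign_div_sqrt_mul_jacobiRaise hα hβ, C_mul, jacobiOrthonormal, mul_assoc]

lemma jacobiSkewOp_jacobiOrthonormal_succ {α β : ℝ} (hα : -1 < α) (hβ : -1 < β) (m : ℕ) :
    jacobiSkewOp α β (jacobiOrthonormal α β (m + 1)) =
      C (tanhJacobiCoeff α β (m + 1)) * jacobiOrthonormal α β (m + 2) -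
        C (tanhJacobiCoeff α β m) * jacobiOrthonormal α β m := by
  rw [jacobiOrthonormal, jacobiSkewOp_C_mul, jacobiSkewOp_jacobiPoly_succ hα hβ, mul_add,
    ← mul_assoc, ← mul_assoc, ← C_mul, ← C_mul, sign_div_sqrt_mul_jacobiRaise hα hβ,
    sign_div_sqrt_mul_jacobiLower hα hβ,
    jacobiOrthonormal, jacobiOrthonormal]
  simp only [C_mul, C_neg]
  ring

/-! ### The affine tanh-Jacobi system -/

lemma hasDerivAt_tanh (x : ℝ) : HasDerivAt Real.tanh (1 - Real.tanh x ^ 2) x := by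
  have hc : Real.cosh x ≠ 0 := (Real.cosh_pos x).ne'
  have h := (Real.hasDerivAt_sinh x).div (Real.hasDerivAt_cosh x) hc
  have he : Real.tanh = Real.sinh / Real.cosh := by
    funext y
    exact Real.tanh_eq_sinh_div_cosh y
  rw [he]
  refine h.congr_deriv ?_
  simp only [Pi.div_apply]
  field_simp

lemma hasDerivAt_artanh {t : ℝ} (ht : t ∈ Ioo (-1 : ℝ) 1) :
    HasDerivAt Real.artanh (1 / (1 - t ^ 2)) t := by
  have h1 : 0 < 1 - t := by linarith [ht.2]
  have h2 : 0 < 1 + t := by linarith [ht.1]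
  have h3 : 1 - t ^ 2 ≠ 0 := by nlinarith
  have hd := ((((hasDerivAt_id t).const_add 1).div ((hasDerivAt_id t).const_sub 1) h1.ne').log
    (div_pos h2 h1).ne').const_mul (1 / 2)
  refine (hd.congr_of_eventuallyEq ?_).congr_deriv ?_
  · filter_upwards [Icc_mem_nhds ht.1 ht.2] with y hy
    exact Real.artanh_eq_half_log hy
  · simp only [id, Pi.div_apply]
    field_simp
    ring

lemma tanh_mem_Ioo (x : ℝ) : Real.tanh x ∈ Ioo (-1 : ℝ) 1 :=
  ⟨Real.neg_one_lt_tanh x, Real.tanh_lt_one x⟩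

lemma one_sub_sq_pos {t : ℝ} (ht : t ∈ Ioo (-1 : ℝ) 1) : 0 < 1 - t ^ 2 := by
  nlinarith [ht.1, ht.2]

lemma hasDerivAt_tanh_affine (κ c x : ℝ) :
    HasDerivAt (fun x => Real.tanh (κ * x + c)) (κ * (1 - Real.tanh (κ * x + c) ^ 2)) x := by
  have h := (hasDerivAt_tanh (κ * x + c)).comp x (((hasDerivAt_id x).const_mul κ).add_const c)
  exact h.congr_deriv (by ring)

lemma range_tanh_affine {κ : ℝ} (hκ : 0 < κ) (c : ℝ) :
    range (fun x => Real.tanh (κ * x + c)) = Ioo (-1) 1 := by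
  ext t
  constructor
  · rintro ⟨x, rfl⟩
    exact tanh_mem_Ioo _
  · intro ht
    refine ⟨(Real.artanh t - c) / κ, ?_⟩
    simp only
    rw [mul_div_cancel₀ _ hκ.ne', sub_add_cancel, Real.tanh_artanh ht]

lemma injective_tanh_affine {κ : ℝ} (hκ : 0 < κ) (c : ℝ) :
    Function.Injective (fun x => Real.tanh (κ * x + c)) := by
  intro x y h
  have := Real.tanh_injective h
  exact mul_left_cancel₀ hκ.ne' (add_right_cancel this)

lemma isMapPair_tanh {κ : ℝ} (hκ : 0 < κ) (c : ℝ) :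
    IsMapPair (fun t => (Real.artanh t - c) / κ) (fun x => Real.tanh (κ * x + c)) where
  differentiableAt t ht := (((hasDerivAt_artanh ht).sub_const c).div_const κ).differentiableAt
  deriv_pos t ht := by
    rw [(((hasDerivAt_artanh ht).sub_const c).div_const κ).deriv]
    exact div_pos (one_div_pos.2 (one_sub_sq_pos ht)) hκ
  mem_Ioo x := tanh_mem_Ioo _
  right_inv x := by
    rw [Real.artanh_tanh, add_sub_cancel_right, mul_div_cancel_left₀ _ hκ.ne']

/-- The common factor of the functions `√κ * tanhJacobi α β m (κ * x + c)`. -/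
def tanhFactor (α β κ c x : ℝ) : ℝ :=
  √κ * ((1 - Real.tanh (κ * x + c)) ^ ((α + 1) / 2) * (1 + Real.tanh (κ * x + c)) ^ ((β + 1) / 2))

lemma sqrt_mul_tanhJacobi (α β κ c : ℝ) (m : ℕ) (x : ℝ) :
    √κ * tanhJacobi α β m (κ * x + c) =
      tanhFactor α β κ c x * (jacobiOrthonormal α β m).eval (Real.tanh (κ * x + c)) := by
  simp only [tanhJacobi, tanhFactor, jacobiOrthonormal, eval_mul, eval_C]
  ring

lemma tanhFactor_pos (α β : ℝ) {κ : ℝ} (hκ : 0 < κ) (c x : ℝ) : 0 < tanhFactor α β κ c x := by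
  have h := tanh_mem_Ioo (κ * x + c)
  exact mul_pos (Real.sqrt_pos.2 hκ) (mul_pos (Real.rpow_pos_of_pos (by linarith [h.2]) _)
    (Real.rpow_pos_of_pos (by linarith [h.1]) _))

lemma hasDerivAt_tanhFactor (α β κ c x : ℝ) :
    HasDerivAt (tanhFactor α β κ c)
      (κ * (tanhFactor α β κ c x * (1 / 2 * (pearsonPoly α β).eval (Real.tanh (κ * x + c))))) x := by
  have hH := hasDerivAt_tanh_affine κ c x
  have hm := tanh_mem_Ioo (κ * x + c)
  set H := fun x => Real.tanh (κ * x + c) with hHdef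
  have h1 : 0 < 1 - H x := by simp only [hHdef]; linarith [hm.2]
  have h2 : 0 < 1 + H x := by simp only [hHdef]; linarith [hm.1]
  have d1 := (hH.const_sub 1).rpow_const (p := (α + 1) / 2) (Or.inl h1.ne')
  have d2 := (hH.const_add 1).rpow_const (p := (β + 1) / 2) (Or.inl h2.ne')
  refine ((d1.mul d2).const_mul (√κ)).congr_deriv ?_
  rw [Real.rpow_sub_one h1.ne', Real.rpow_sub_one h2.ne', pearsonPoly, tanhFactor]
  change _ = κ * (√κ * ((1 - H x) ^ ((α + 1) / 2) * (1 + H x) ^ ((β + 1) / 2)) *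
    (1 / 2 * eval (H x) _))
  change √κ * (-(κ * (1 - H x ^ 2)) * _ * _ * (1 + H x) ^ ((β + 1) / 2) +
    (1 - H x) ^ ((α + 1) / 2) * (κ * (1 - H x ^ 2) * _ * _)) = _
  simp only [eval_sub, eval_mul, eval_C, eval_X]
  field_simp
  ring

/-- In the variable `t = tanh (κ x + c)`, differentiation acts as `κ` times `jacobiSkewOp`. -/
lemma hasDerivAt_tanhFactor_mul_eval (α β κ c : ℝ) (p : ℝ[X]) (x : ℝ) :
    HasDerivAt (fun x => tanhFactor α β κ c x * p.eval (Real.tanh (κ * x + c)))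
      (κ * (tanhFactor α β κ c x * (jacobiSkewOp α β p).eval (Real.tanh (κ * x + c)))) x := by
  have hp := (p.hasDerivAt (Real.tanh (κ * x + c))).comp x (hasDerivAt_tanh_affine κ c x)
  refine ((hasDerivAt_tanhFactor α β κ c x).mul hp).congr_deriv ?_
  simp only [jacobiSkewOp, eval_add, eval_sub, eval_mul, eval_pow, eval_one, eval_X, eval_C,
    Function.comp_apply]
  ring

lemma hasDerivAt_tanhJacobi_zero {α β : ℝ} (hα : -1 < α) (hβ : -1 < β) (κ c x : ℝ) :
    HasDerivAt (fun x => √κ * tanhJacobi α β 0 (κ * x + c))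
      (κ * tanhJacobiCoeff α β 0 * (√κ * tanhJacobi α β 1 (κ * x + c))) x := by
  simp only [sqrt_mul_tanhJacobi]
  refine (hasDerivAt_tanhFactor_mul_eval α β κ c _ x).congr_deriv ?_
  rw [jacobiSkewOp_jacobiOrthonormal_zero hα hβ, eval_mul, eval_C]
  ring

lemma hasDerivAt_tanhJacobi_succ {α β : ℝ} (hα : -1 < α) (hβ : -1 < β) (κ c : ℝ) (m : ℕ) (x : ℝ) :
    HasDerivAt (fun x => √κ * tanhJacobi α β (m + 1) (κ * x + c))
      (κ * tanhJacobiCoeff α β (m + 1) * (√κ * tanhJacobi α β (m + 2) (κ * x + c)) -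
        κ * tanhJacobiCoeff α β m * (√κ * tanhJacobi α β m (κ * x + c))) x := by
  simp only [sqrt_mul_tanhJacobi]
  refine (hasDerivAt_tanhFactor_mul_eval α β κ c _ x).congr_deriv ?_
  rw [jacobiSkewOp_jacobiOrthonormal_succ hα hβ, eval_sub, eval_mul, eval_mul, eval_C, eval_C]
  ring

lemma rpow_half_add_one_mul_self {a : ℝ} (ha : 0 < a) (s : ℝ) :
    a ^ ((s + 1) / 2) * a ^ ((s + 1) / 2) = a ^ s * a := by
  rw [← Real.rpow_add ha, add_halves, Real.rpow_add_one ha.ne']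

lemma tanhFactor_mul_self (α β : ℝ) {κ : ℝ} (hκ : 0 < κ) (c x : ℝ) :
    tanhFactor α β κ c x * tanhFactor α β κ c x =
      κ * (1 - Real.tanh (κ * x + c) ^ 2) * jacobiWeight α β (Real.tanh (κ * x + c)) := by
  have h := tanh_mem_Ioo (κ * x + c)
  have h1 : 0 < 1 - Real.tanh (κ * x + c) := by linarith [h.2]
  have h2 : 0 < 1 + Real.tanh (κ * x + c) := by linarith [h.1]
  have e1 := rpow_half_add_one_mul_self h1 α
  have e2 := rpow_half_add_one_mul_self h2 β
  have e3 := Real.mul_self_sqrt hκ.le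
  rw [tanhFactor, jacobiWeight]
  calc _ = (√κ * √κ) * ((1 - Real.tanh (κ * x + c)) ^ ((α + 1) / 2) *
        (1 - Real.tanh (κ * x + c)) ^ ((α + 1) / 2)) *
        ((1 + Real.tanh (κ * x + c)) ^ ((β + 1) / 2) *
        (1 + Real.tanh (κ * x + c)) ^ ((β + 1) / 2)) := by ring
    _ = _ := by rw [e1, e2, e3]; ring

/-- The substitution `t = tanh (κ x + c)`. -/
lemma integral_tanhFactor_sq_mul (α β : ℝ) {κ : ℝ} (hκ : 0 < κ) (c : ℝ) (p : ℝ[X]) :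
    ∫ x, tanhFactor α β κ c x * tanhFactor α β κ c x * p.eval (Real.tanh (κ * x + c)) =
      jacobiIntegral α β p := by
  have h := integral_image_eq_integral_abs_deriv_smul (s := univ) MeasurableSet.univ
    (fun x _ => (hasDerivAt_tanh_affine κ c x).hasDerivWithinAt)
    (injective_tanh_affine hκ c).injOn (fun t => jacobiWeight α β t * p.eval t)
  rw [image_univ, range_tanh_affine hκ, Measure.restrict_univ] at h
  rw [jacobiIntegral, h]
  congr 1
  funext x
  rw [tanhFactor_mul_self α β hκ, smul_eq_mul,
    abs_of_pos (mul_pos hκ (one_sub_sq_pos (tanh_mem_Ioo _)))]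
  ring

lemma integrable_tanhFactor_sq_mul {α β : ℝ} (hα : -1 < α) (hβ : -1 < β) {κ : ℝ} (hκ : 0 < κ) (c : ℝ)
    (p : ℝ[X]) :
    Integrable
      (fun x => tanhFactor α β κ c x * tanhFactor α β κ c x * p.eval (Real.tanh (κ * x + c))) := by
  have h := (integrableOn_image_iff_integrableOn_abs_deriv_smul (s := univ) MeasurableSet.univ
    (fun x _ => (hasDerivAt_tanh_affine κ c x).hasDerivWithinAt)
    (injective_tanh_affine hκ c).injOn (fun t => jacobiWeight α β t * p.eval t)).1
    (by rw [image_univ, range_tanh_affine hκ]; exact integrableOn_jacobiWeight_mul hα hβ p)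
  rw [integrableOn_univ] at h
  refine h.congr (Filter.Eventually.of_forall fun x => ?_)
  simp only
  rw [tanhFactor_mul_self α β hκ, smul_eq_mul,
    abs_of_pos (mul_pos hκ (one_sub_sq_pos (tanh_mem_Ioo _)))]
  ring

lemma integral_tanhJacobi_mul {α β : ℝ} (hα : -1 < α) (hβ : -1 < β) {κ : ℝ} (hκ : 0 < κ) (c : ℝ)
    (m n : ℕ) :
    ∫ x, (√κ * tanhJacobi α β m (κ * x + c)) * (√κ * tanhJacobi α β n (κ * x + c)) =
      if m = n then 1 else 0 := by
  rw [← jacobiIntegral_jacobiOrthonormal hα hβ, ← integral_tanhFactor_sq_mul α β hκ c]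
  congr 1
  funext x
  rw [sqrt_mul_tanhJacobi, sqrt_mul_tanhJacobi, eval_mul]
  ring

lemma memLp_tanhJacobi {α β : ℝ} (hα : -1 < α) (hβ : -1 < β) {κ : ℝ} (hκ : 0 < κ) (c : ℝ) (m : ℕ) :
    MemLp (fun x => √κ * tanhJacobi α β m (κ * x + c)) 2 volume := by
  have hc : Continuous (fun x => √κ * tanhJacobi α β m (κ * x + c)) := by
    rw [continuous_iff_continuousAt]
    intro x
    simp only [sqrt_mul_tanhJacobi]
    exact (hasDerivAt_tanhFactor_mul_eval α β κ c _ x).continuousAt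
  rw [memLp_two_iff_integrable_sq hc.aestronglyMeasurable]
  refine (integrable_tanhFactor_sq_mul hα hβ hκ c
    (jacobiOrthonormal α β m * jacobiOrthonormal α β m)).congr
    (Filter.Eventually.of_forall fun x => ?_)
  simp only [sqrt_mul_tanhJacobi, eval_mul]
  ring

lemma IsAffineTanhJacobi.isOrthonormalSystem {φ : ℕ → ℝ → ℝ} {D : Matrix ℕ ℕ ℝ}
    (hφ : IsAffineTanhJacobi φ D) : IsOrthonormalSystem φ := by
  obtain ⟨α, β, κ, c, s, hα, hβ, hκ, hs, hφ, -, -⟩ := hφ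
  constructor
  · intro m
    have := (memLp_tanhJacobi hα hβ hκ c m).const_mul (s m)
    exact (funext (hφ m)) ▸ this
  · intro m n
    have h := integral_tanhJacobi_mul hα hβ hκ c m n
    have : (fun x => φ m x * φ n x) = fun x => (s m * s n) *
        ((√κ * tanhJacobi α β m (κ * x + c)) * (√κ * tanhJacobi α β n (κ * x + c))) := by
      funext x
      rw [hφ, hφ]
      ring
    rw [this, integral_const_mul, h]
    split_ifs with hmn
    · rw [hmn, mul_self_eq_one_iff.2 (hs n), one_mul]
    · rw [mul_zero]

lemma IsAffineTanhJacobi.isSkewTridiagonalIrreducible {φ : ℕ → ℝ → ℝ} {D : Matrix ℕ ℕ ℝ}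
    (hφ : IsAffineTanhJacobi φ D) : IsSkewTridiagonalIrreducible D := by
  obtain ⟨α, β, κ, c, s, hα, hβ, hκ, hs, -, hD, -⟩ := hφ
  have hs0 : ∀ m, s m ≠ 0 := fun m h => by
    have := mul_self_eq_one_iff.2 (hs m)
    simp [h] at this
  have hup : ∀ m, D m (m + 1) ≠ 0 := by
    intro m
    rw [hD, if_pos rfl]
    exact mul_ne_zero (mul_ne_zero (hs0 _) (hs0 _))
      (mul_ne_zero hκ.ne' (tanhJacobiCoeff_pos hα hβ m).ne')
  have hskew : ∀ m n, D m n = -D n m := by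
    intro m n
    rw [hD m n, hD n m]
    by_cases h1 : n = m + 1
    · subst h1
      rw [if_pos rfl, if_neg (by omega), if_pos rfl]
      ring
    · by_cases h2 : m = n + 1
      · subst h2
        rw [if_neg (by omega), if_pos rfl, if_pos rfl]
        ring
      · rw [if_neg h1, if_neg h2, if_neg h2, if_neg h1, neg_zero]
  have hdown : ∀ m, D (m + 1) m ≠ 0 := fun m => by
    rw [hskew]
    exact neg_ne_zero.2 (hup m)
  refine ⟨hskew, fun m n h => ?_, fun m n => ?_⟩
  · rw [hD, if_neg (by omega), if_neg (by omega)]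
  · have h1 : ∀ k, Relation.ReflTransGen (fun i j => D i j ≠ 0) 0 k := by
      intro k
      induction k with
      | zero => exact .refl
      | succ k ih => exact ih.tail (hup k)
    have h2 : ∀ k, Relation.ReflTransGen (fun i j => D i j ≠ 0) k 0 := by
      intro k
      induction k with
      | zero => exact .refl
      | succ k ih => exact .head (hdown k) ih
    exact (h2 m).trans (h1 n)

lemma hasSum_tridiagonal_zero {a : ℕ → ℝ} (h0 : a 0 = 0) (ha : ∀ k, 1 < k → a k = 0) :
    HasSum a (a 1) := by
  refine hasSum_single 1 fun k hk => ?_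
  rcases Nat.lt_or_gt_of_ne hk with h | h
  · rwa [Nat.lt_one_iff.1 h]
  · exact ha k h

lemma hasSum_tridiagonal_succ {a : ℕ → ℝ} {m : ℕ} (h0 : a (m + 1) = 0)
    (ha : ∀ k, m + 1 + 1 < k ∨ k + 1 < m + 1 → a k = 0) : HasSum a (a m + a (m + 2)) := by
  have h := hasSum_sum_of_ne_finset_zero (f := a) (s := {m, m + 2}) (fun k hk => ?_)
    (L := SummationFilter.unconditional ℕ)
  · rwa [Finset.sum_pair (by omega)] at h
  · simp only [Finset.mem_insert, Finset.mem_singleton, not_or] at hk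
    by_cases hk1 : k = m + 1
    · rw [hk1, h0]
    · exact ha k (by omega)

lemma IsAffineTanhJacobi.isDifferentiationMatrix {φ : ℕ → ℝ → ℝ} {D : Matrix ℕ ℕ ℝ}
    (hφ : IsAffineTanhJacobi φ D) : IsDifferentiationMatrix D φ := by
  obtain ⟨hskew, htri, -⟩ := hφ.isSkewTridiagonalIrreducible
  have hdiag : ∀ m, D m m = 0 := fun m => by linarith [hskew m m]
  obtain ⟨α, β, κ, c, s, hα, hβ, hκ, hs, hφ, hD, -⟩ := hφ
  have hup : ∀ m, D m (m + 1) = s m * s (m + 1) * (κ * tanhJacobiCoeff α β m) := fun m => by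
    rw [hD, if_pos rfl]
  intro m x
  have hfun : φ m = fun x => s m * (√κ * tanhJacobi α β m (κ * x + c)) := funext (hφ m)
  rcases m with _ | m
  · have hd := (hasDerivAt_tanhJacobi_zero hα hβ κ c x).const_mul (s 0)
    rw [← hfun] at hd
    refine ⟨hd.differentiableAt, ?_⟩
    have h := hasSum_tridiagonal_zero (a := fun k => D 0 k * φ k x) (by simp [hdiag])
      (fun k hk => by rw [htri 0 k (by omega), zero_mul])
    convert h using 1
    rw [hd.deriv, hφ 1 x, hup 0, zero_add]
    linear_combination -(s 0 * κ * tanhJacobiCoeff α β 0 *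
      (√κ * tanhJacobi α β 1 (κ * x + c))) * mul_self_eq_one_iff.2 (hs 1)
  · have hd := (hasDerivAt_tanhJacobi_succ hα hβ κ c m x).const_mul (s (m + 1))
    rw [← hfun] at hd
    refine ⟨hd.differentiableAt, ?_⟩
    have h := hasSum_tridiagonal_succ (a := fun k => D (m + 1) k * φ k x) (m := m) (by simp [hdiag])
      (fun k hk => by rw [htri (m + 1) k hk, zero_mul])
    convert h using 1
    rw [hd.deriv, hφ m x, hφ (m + 2) x, hskew (m + 1) m, hup m, hup (m + 1)]
    linear_combination -(s (m + 1) * κ * tanhJacobiCoeff α β (m + 1) *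
      (√κ * tanhJacobi α β (m + 2) (κ * x + c))) * mul_self_eq_one_iff.2 (hs (m + 2)) +
      (s (m + 1) * κ * tanhJacobiCoeff α β m *
      (√κ * tanhJacobi α β m (κ * x + c))) * mul_self_eq_one_iff.2 (hs m)

lemma isWeight_jacobiWeight {α β : ℝ} (hα : -1 < α) (hβ : -1 < β) : IsWeight (jacobiWeight α β) :=
  ⟨fun _ ht => (jacobiWeight_pos α β ht).le, integrableOn_jacobiWeight hα hβ⟩

lemma IsAffineTanhJacobi.exists_isMappedPolySystem {φ : ℕ → ℝ → ℝ} {D : Matrix ℕ ℕ ℝ}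
    (hφ : IsAffineTanhJacobi φ D) :
    ∃ (W : ℝ → ℝ) (q : ℕ → ℝ[X]) (h H Θ θ : ℝ → ℝ),
      IsMappedPolySystem W q h H Θ φ ∧ IsCoefficientFactor W h H Θ θ := by
  obtain ⟨α, β, κ, c, s, hα, hβ, hκ, hs, hφ, -, -⟩ := hφ
  have hs0 : ∀ m, s m ≠ 0 := fun m h => by
    have := mul_self_eq_one_iff.2 (hs m)
    simp [h] at this
  -- `Θ = θ(H) H' W(H)` and `Θ² = H' W(H)` force `θ √(W / h') = 1`.
  refine ⟨jacobiWeight α β, fun m => C (s m) * jacobiOrthonormal α β m,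
    fun t => (Real.artanh t - c) / κ, fun x => Real.tanh (κ * x + c), tanhFactor α β κ c,
    fun t => (√(κ * (1 - t ^ 2) * jacobiWeight α β t))⁻¹, ⟨isWeight_jacobiWeight hα hβ, ⟨?_, ?_⟩,
    isMapPair_tanh hκ c, ?_⟩, ⟨?_, ?_⟩⟩
  · intro m
    rw [degree_C_mul (hs0 m), degree_jacobiOrthonormal hα hβ]
  · intro m n
    have h := jacobiIntegral_jacobiOrthonormal hα hβ m n
    have : (fun t => (C (s m) * jacobiOrthonormal α β m).eval t *
        (C (s n) * jacobiOrthonormal α β n).eval t * jacobiWeight α β t) =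
        fun t => (s m * s n) * (jacobiWeight α β t *
          (jacobiOrthonormal α β m * jacobiOrthonormal α β n).eval t) := by
      funext t
      simp only [eval_mul, eval_C]
      ring
    rw [this, integral_const_mul]
    change s m * s n * jacobiIntegral α β _ = _
    rw [h]
    split_ifs with hmn
    · rw [hmn, mul_self_eq_one_iff.2 (hs n), one_mul]
    · rw [mul_zero]
  · intro m x
    rw [hφ, sqrt_mul_tanhJacobi, eval_mul, eval_C]
    ring
  · refine (memLp_const (1 : ℝ)).ae_eq ?_
    filter_upwards [ae_restrict_mem measurableSet_Ioo] with t ht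
    have h1 := one_sub_sq_pos ht
    have h2 := jacobiWeight_pos α β ht
    rw [(((hasDerivAt_artanh ht).sub_const c).div_const κ).deriv,
      show jacobiWeight α β t / (1 / (1 - t ^ 2) / κ) = κ * (1 - t ^ 2) * jacobiWeight α β t by
        field_simp]
    exact (inv_mul_cancel₀ (Real.sqrt_pos.2 (mul_pos (mul_pos hκ h1) h2)).ne').symm
  · intro x
    have hpos := tanhFactor_pos α β hκ c x
    rw [(hasDerivAt_tanh_affine κ c x).deriv, mul_assoc, ← tanhFactor_mul_self α β hκ,
      Real.sqrt_mul_self hpos.le, inv_mul_cancel_left₀ hpos.ne']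

/-! ### Uniqueness of orthonormal polynomials -/

lemma map_mul_eq_zero_of_degree_lt (ℓ : ℝ[X] →ₗ[ℝ] ℝ) {p : ℕ → ℝ[X]}
    (hdeg : ∀ m, (p m).degree = (m : WithBot ℕ))
    (hp : ∀ m n, ℓ (p m * p n) = if m = n then 1 else 0) {m : ℕ} {u : ℝ[X]}
    (hu : u.degree < (m : WithBot ℕ)) : ℓ (p m * u) = 0 := by
  let S : Polynomial.Sequence ℝ := ⟨p, hdeg⟩
  have hS : ∀ i, S i = p i := fun _ => rfl
  have hspan : u ∈ Submodule.span ℝ (S '' Set.Iio m) := by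
    rw [S.span_degreeLT fun i _ => (leadingCoeff_ne_zero.2 (S.ne_zero i)).isUnit]
    exact mem_degreeLT.2 hu
  have hle : Submodule.span ℝ (S '' Set.Iio m) ≤
      LinearMap.ker (ℓ ∘ₗ LinearMap.mulLeft ℝ (p m)) := by
    rw [Submodule.span_le]
    rintro _ ⟨i, hi, rfl⟩
    have hi' : i < m := hi
    simp [hS, hp, hi'.ne']
  exact hle hspan

/-- Two sequences of polynomials, orthonormal for the same positive definite functional, with the
`m`-th polynomial of degree `m`, agree up to signs. -/
lemma eq_or_eq_neg_of_orthonormal (ℓ : ℝ[X] →ₗ[ℝ] ℝ) (hpos : ∀ r, r ≠ 0 → 0 < ℓ (r * r))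
    {p q : ℕ → ℝ[X]} (hpd : ∀ m, (p m).degree = (m : WithBot ℕ))
    (hp : ∀ m n, ℓ (p m * p n) = if m = n then 1 else 0)
    (hqd : ∀ m, (q m).degree = (m : WithBot ℕ))
    (hq : ∀ m n, ℓ (q m * q n) = if m = n then 1 else 0) (m : ℕ) :
    q m = p m ∨ q m = -p m := by
  have hp0 : p m ≠ 0 := fun h => by simpa [h] using hpd m
  have hq0 : q m ≠ 0 := fun h => by simpa [h] using hqd m
  have hlp := leadingCoeff_ne_zero.2 hp0
  have hlq := leadingCoeff_ne_zero.2 hq0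
  set c : ℝ := (q m).leadingCoeff / (p m).leadingCoeff with hc
  have hc0 : c ≠ 0 := div_ne_zero hlq hlp
  have hr : (q m - C c * p m).degree < (m : WithBot ℕ) := by
    rw [← hqd m]
    refine degree_sub_lt_left ?_ hq0 ?_
    · rw [degree_C_mul hc0, hpd, hqd]
    · rw [leadingCoeff_mul, leadingCoeff_C, hc, div_mul_cancel₀ _ hlp]
  have hrr : ℓ ((q m - C c * p m) * (q m - C c * p m)) = 0 := by
    have h1 := map_mul_eq_zero_of_degree_lt ℓ hpd hp hr
    have h2 := map_mul_eq_zero_of_degree_lt ℓ hqd hq hr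
    have h3 : (q m - C c * p m) * (q m - C c * p m) =
        q m * (q m - C c * p m) - c • (p m * (q m - C c * p m)) := by
      rw [smul_eq_C_mul]
      ring
    rw [h3, map_sub, map_smul, h1, h2, smul_zero, sub_zero]
  have heq : q m = C c * p m := by
    by_contra h
    exact (hpos _ (sub_ne_zero.2 h)).ne' hrr
  have hcc : c * c = 1 := by
    have h1 := hq m m
    have h2 : q m * q m = (c * c) • (p m * p m) := by
      rw [smul_eq_C_mul, heq, C_mul]
      ring
    rw [h2, map_smul, hp, if_pos rfl, smul_eq_mul, mul_one] at h1
    exact h1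
  rcases mul_self_eq_one_iff.1 hcc with h | h
  · left; rw [heq, h, C_1, one_mul]
  · right; rw [heq, h, C_neg, C_1, neg_one_mul]

/-! ### The two differential equations of a mapped system -/

lemma IsMapPair.strictMonoOn {h H : ℝ → ℝ} (hH : IsMapPair h H) :
    StrictMonoOn h (Ioo (-1 : ℝ) 1) := by
  refine strictMonoOn_of_deriv_pos (convex_Ioo _ _) ?_ ?_
  · exact fun t ht => (hH.differentiableAt t ht).continuousAt.continuousWithinAt
  · intro t ht
    rw [interior_Ioo] at ht
    exact hH.deriv_pos t ht

lemma IsMapPair.left_inv {h H : ℝ → ℝ} (hH : IsMapPair h H) {t : ℝ} (ht : t ∈ Ioo (-1 : ℝ) 1) :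
    H (h t) = t :=
  hH.strictMonoOn.injOn (hH.mem_Ioo _) ht (hH.right_inv _)

lemma IsMapPair.monotone {h H : ℝ → ℝ} (hH : IsMapPair h H) : Monotone H := by
  intro x y hxy
  rw [← hH.strictMonoOn.le_iff_le (hH.mem_Ioo x) (hH.mem_Ioo y), hH.right_inv, hH.right_inv]
  exact hxy

lemma IsMapPair.continuous {h H : ℝ → ℝ} (hH : IsMapPair h H) : Continuous H := by
  rw [continuous_iff_continuousAt]
  intro x
  refine continuousAt_of_monotoneOn_of_image_mem_nhds (s := univ) (hH.monotone.monotoneOn _)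
    Filter.univ_mem ?_
  refine Filter.mem_of_superset (isOpen_Ioo.mem_nhds (hH.mem_Ioo x)) fun t ht => ?_
  exact ⟨h t, mem_univ _, hH.left_inv ht⟩

lemma IsMapPair.hasDerivAt {h H : ℝ → ℝ} (hH : IsMapPair h H) (x : ℝ) :
    HasDerivAt H (deriv h (H x))⁻¹ x :=
  HasDerivAt.of_local_left_inverse hH.continuous.continuousAt
    (hH.differentiableAt _ (hH.mem_Ioo x)).hasDerivAt (hH.deriv_pos _ (hH.mem_Ioo x)).ne'
    (Filter.Eventually.of_forall hH.right_inv)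

/-- A solution of a linear first-order equation that vanishes somewhere vanishes everywhere. -/
lemma ne_zero_of_hasDerivAt_mul {a f : ℝ → ℝ} (ha : Continuous a)
    (hf : ∀ x, HasDerivAt f (a x * f x) x) {x₀ : ℝ} (h0 : f x₀ ≠ 0) (x : ℝ) : f x ≠ 0 := by
  have hE : ∀ y, HasDerivAt (fun y => f y * Real.exp (-∫ u in (0 : ℝ)..y, a u)) 0 y := by
    intro y
    have h1 : HasDerivAt (fun y => ∫ u in (0 : ℝ)..y, a u) (a y) y :=
      intervalIntegral.integral_hasDerivAt_right (ha.intervalIntegrable _ _)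
        (ha.stronglyMeasurableAtFilter _ _) ha.continuousAt
    exact ((hf y).mul h1.neg.exp).congr_deriv (by ring)
  have hconst := is_const_of_deriv_eq_zero (fun y => (hE y).differentiableAt)
    (fun y => (hE y).deriv) x x₀
  intro hx
  simp only [hx, zero_mul] at hconst
  exact mul_ne_zero h0 (Real.exp_pos _).ne' hconst.symm

/-- If `H` solves `H' = w(H)` on all of `ℝ` and stays in `(-1, 1)`, where `w > 0`, then the equation has
an equilibrium at the endpoint `1`: otherwise `H'` would be bounded below on a half-line. -/
lemma eq_zero_at_one_of_autonomous {H w : ℝ → ℝ} (hw : Continuous w)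
    (hd : ∀ x, HasDerivAt H (w (H x)) x) (hmem : ∀ x, H x ∈ Ioo (-1 : ℝ) 1)
    (hpos : ∀ t ∈ Ioo (-1 : ℝ) 1, 0 < w t) : w 1 = 0 := by
  by_contra hne
  have hnn : 0 ≤ w 1 := by
    have hcl : closure (Ioo (-1 : ℝ) 1) ⊆ {t | 0 ≤ w t} :=
      closure_minimal (fun t ht => (hpos t ht).le) (isClosed_le continuous_const hw)
    rw [closure_Ioo (by norm_num)] at hcl
    exact hcl (right_mem_Icc.2 (by norm_num))
  have h1 : 0 < w 1 := lt_of_le_of_ne hnn (Ne.symm hne)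
  have hmono : Monotone H :=
    monotone_of_deriv_nonneg (fun x => (hd x).differentiableAt) fun x => by
      rw [(hd x).deriv]
      exact (hpos _ (hmem x)).le
  obtain ⟨t₀, ht₀, hmin⟩ := (isCompact_Icc (a := H 0) (b := 1)).exists_isMinOn
    ⟨1, right_mem_Icc.2 (hmem 0).2.le⟩ hw.continuousOn
  have hδ : 0 < w t₀ := by
    rcases eq_or_lt_of_le ht₀.2 with h | h
    · rwa [h]
    · exact hpos _ ⟨lt_of_lt_of_le (hmem 0).1 ht₀.1, h⟩
  have hx : (0 : ℝ) ≤ 2 / w t₀ := (div_pos two_pos hδ).le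
  have hmvt := (convex_Ici (0 : ℝ)).mul_sub_le_image_sub_of_le_deriv (f := H) (C := w t₀)
    (fun x _ => (hd x).continuousAt.continuousWithinAt)
    (fun x _ => (hd x).differentiableAt.differentiableWithinAt)
    (fun x hx => by
      rw [interior_Ici] at hx
      rw [(hd x).deriv]
      exact hmin ⟨hmono (le_of_lt hx), (hmem x).2.le⟩)
    0 self_mem_Ici (2 / w t₀) hx hx
  rw [sub_zero, mul_div_cancel₀ _ hδ.ne'] at hmvt
  linarith [(hmem 0).1, (hmem (2 / w t₀)).2]

lemma eq_zero_at_neg_one_of_autonomous {H w : ℝ → ℝ} (hw : Continuous w)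
    (hd : ∀ x, HasDerivAt H (w (H x)) x) (hmem : ∀ x, H x ∈ Ioo (-1 : ℝ) 1)
    (hpos : ∀ t ∈ Ioo (-1 : ℝ) 1, 0 < w t) : w (-1) = 0 := by
  refine eq_zero_at_one_of_autonomous (H := fun x => -H (-x)) (w := fun t => w (-t))
    (hw.comp continuous_neg) (fun x => ?_) (fun x => ?_) fun t ht => ?_
  · have := ((hd (-x)).comp x (hasDerivAt_neg x)).neg
    refine this.congr_deriv ?_
    rw [neg_neg]
    ring
  · exact ⟨by linarith [(hmem (-x)).2], by linarith [(hmem (-x)).1]⟩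
  · exact hpos _ ⟨by linarith [ht.2], by linarith [ht.1]⟩

/-- A solution of `H' = w(H)` on all of `ℝ` that stays in `(-1, 1)`, where `w > 0`, is an affine
`tanh` if `w` is a polynomial of degree at most two: its zeros `±1` leave only `w = κ (1 - t²)`. -/
lemma exists_eq_tanh_of_quadratic {H : ℝ → ℝ} {w : ℝ[X]} (hw : w.degree ≤ 2)
    (hd : ∀ x, HasDerivAt H (w.eval (H x)) x) (hmem : ∀ x, H x ∈ Ioo (-1 : ℝ) 1)
    (hpos : ∀ t ∈ Ioo (-1 : ℝ) 1, 0 < w.eval t) :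
    ∃ κ c : ℝ, 0 < κ ∧ ∀ x, H x = Real.tanh (κ * x + c) := by
  have h1 := eq_zero_at_one_of_autonomous w.continuous hd hmem hpos
  have h2 := eq_zero_at_neg_one_of_autonomous w.continuous hd hmem hpos
  have h0 := hpos 0 (by norm_num)
  have hquad := eq_quadratic_of_degree_le_two hw
  have heval : ∀ t, w.eval t = w.coeff 2 * t ^ 2 + w.coeff 1 * t + w.coeff 0 := by
    intro t
    conv_lhs => rw [hquad]
    simp
  rw [heval] at h1 h2 h0
  set κ := w.coeff 0
  have hκ : 0 < κ := by linarith
  have hd' : ∀ x, HasDerivAt H (κ * (1 - H x ^ 2)) x := by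
    intro x
    refine (hd x).congr_deriv ?_
    rw [heval]
    have e1 : w.coeff 1 = 0 := by linarith
    have e2 : w.coeff 2 = -κ := by linarith
    rw [e1, e2]
    ring
  have hart : ∀ x, HasDerivAt (fun x => Real.artanh (H x) - κ * x) 0 x := by
    intro x
    refine (((hasDerivAt_artanh (hmem x)).comp x (hd' x)).sub
      ((hasDerivAt_id x).const_mul κ)).congr_deriv ?_
    have := (one_sub_sq_pos (hmem x)).ne'
    field_simp
    ring
  refine ⟨κ, Real.artanh (H 0), hκ, fun x => ?_⟩
  have hconst := is_const_of_deriv_eq_zero (fun y => (hart y).differentiableAt)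
    (fun y => (hart y).deriv) x 0
  have hx : κ * x + Real.artanh (H 0) = Real.artanh (H x) := by
    simp only [mul_zero, sub_zero] at hconst
    linarith
  rw [hx, Real.tanh_artanh (hmem x)]

lemma hasDerivAt_zero_of_tridiagonal {φ : ℕ → ℝ → ℝ} {D : Matrix ℕ ℕ ℝ}
    (hD : IsSkewTridiagonalIrreducible D) (hφ : IsDifferentiationMatrix D φ) (x : ℝ) :
    HasDerivAt (φ 0) (D 0 1 * φ 1 x) x := by
  have hdiag : D 0 0 = 0 := by linarith [hD.skew 0 0]
  have h := hasSum_tridiagonal_zero (a := fun k => D 0 k * φ k x) (by simp [hdiag])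
    (fun k hk => by rw [hD.tridiagonal 0 k (by omega), zero_mul])
  have := (hφ 0 x).1.hasDerivAt
  rwa [(hφ 0 x).2.unique h] at this

lemma hasDerivAt_succ_of_tridiagonal {φ : ℕ → ℝ → ℝ} {D : Matrix ℕ ℕ ℝ}
    (hD : IsSkewTridiagonalIrreducible D) (hφ : IsDifferentiationMatrix D φ) (m : ℕ) (x : ℝ) :
    HasDerivAt (φ (m + 1)) (D (m + 1) (m + 2) * φ (m + 2) x - D m (m + 1) * φ m x) x := by
  have hdiag : D (m + 1) (m + 1) = 0 := by linarith [hD.skew (m + 1) (m + 1)]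
  have h := hasSum_tridiagonal_succ (a := fun k => D (m + 1) k * φ k x) (m := m) (by simp [hdiag])
    (fun k hk => by rw [hD.tridiagonal (m + 1) k hk, zero_mul])
  have hd := (hφ (m + 1) x).1.hasDerivAt
  rw [(hφ (m + 1) x).2.unique h] at hd
  refine hd.congr_deriv ?_
  rw [hD.skew (m + 1) m]
  ring

/-- The first two rows of the differentiation matrix are differential equations for `Θ` and `H`:
`Θ` satisfies a linear equation whose coefficient has degree one in `H`, and `H' = w(H)` with `w` of
degree at most two; the latter forces `H` to be an affine `tanh`. -/
lemma exists_eq_tanh_of_mapped {φ : ℕ → ℝ → ℝ} {D : Matrix ℕ ℕ ℝ} {W h H Θ : ℝ → ℝ} {q : ℕ → ℝ[X]}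
    (hsys : IsMappedPolySystem W q h H Θ φ) (horth : IsOrthonormalSystem φ)
    (hD : IsSkewTridiagonalIrreducible D) (hφ : IsDifferentiationMatrix D φ) :
    ∃ κ c A B : ℝ, 0 < κ ∧ (∀ x, H x = Real.tanh (κ * x + c)) ∧
      (∀ x, HasDerivAt Θ ((A + B * H x) * Θ x) x) ∧ ∀ x, Θ x ≠ 0 := by
  obtain ⟨a, ha0, hq0⟩ : ∃ a : ℝ, a ≠ 0 ∧ q 0 = C a := by
    have h := hsys.orthonormal.degree_eq 0
    have h' := eq_C_of_degree_eq_zero h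
    refine ⟨(q 0).coeff 0, fun h0 => ?_, h'⟩
    rw [h', h0] at h
    simp at h
  obtain ⟨k, l, hk0, hq1⟩ : ∃ k l : ℝ, k ≠ 0 ∧ q 1 = C k * X + C l := by
    have h := hsys.orthonormal.degree_eq 1
    have h' := eq_X_add_C_of_degree_le_one h.le
    refine ⟨(q 1).coeff 1, (q 1).coeff 0, fun h0 => ?_, h'⟩
    rw [h', h0] at h
    have := degree_C_le (a := (q 1).coeff 0)
    rw [C_0, zero_mul, zero_add] at h
    rw [h] at this
    exact absurd this (by norm_num)
  have hΘeq : Θ = fun x => a⁻¹ * φ 0 x := by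
    funext x
    rw [hsys.eq, hq0, eval_C]
    field_simp
  set b := D 0 1
  have hΘ : ∀ x, HasDerivAt Θ ((b / a * l + b / a * k * H x) * Θ x) x := by
    intro x
    have hd := (hasDerivAt_zero_of_tridiagonal hD hφ x).const_mul a⁻¹
    rw [← hΘeq] at hd
    refine hd.congr_deriv ?_
    rw [hsys.eq 1, hq1]
    simp only [eval_add, eval_mul, eval_C, eval_X]
    field_simp
    ring
  have hne : ∀ x, Θ x ≠ 0 := by
    obtain ⟨x₀, hx₀⟩ : ∃ x₀, Θ x₀ ≠ 0 := by
      by_contra! hzero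
      have h := horth.integral_eq 0 0
      simp [hsys.eq, hzero] at h
    refine ne_zero_of_hasDerivAt_mul (a := fun x => b / a * l + b / a * k * H x) ?_ hΘ hx₀
    exact continuous_const.add (continuous_const.mul hsys.map.continuous)
  set w : ℝ[X] := C k⁻¹ * (C (D 1 2) * q 2 - C (b * a) - C (b / a) * (C k * X + C l) ^ 2) with hw
  have hwdeg : w.degree ≤ 2 := by
    have hq2 : (q 2).degree ≤ 2 := (hsys.orthonormal.degree_eq 2).le
    have hq2' : (q 2).natDegree ≤ 2 := natDegree_le_of_degree_le hq2
    refine degree_le_of_natDegree_le ?_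
    rw [hw]
    compute_degree!
  have hHw : ∀ x, (deriv h (H x))⁻¹ = w.eval (H x) := by
    intro x
    have h1 := hasDerivAt_succ_of_tridiagonal hD hφ 0 x
    have h2 := (hΘ x).mul (((q 1).hasDerivAt (H x)).comp x (hsys.map.hasDerivAt x))
    have hfun : φ 1 = fun x => Θ x * (q 1).eval (H x) := funext (hsys.eq 1)
    rw [zero_add, hfun] at h1
    have h3 := h1.unique h2
    rw [hsys.eq 2, hsys.eq 0, hq0, hq1] at h3
    simp only [eval_add, eval_mul, eval_C, eval_X, Function.comp_apply, derivative_add,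
      derivative_mul, derivative_C, derivative_X, zero_mul, zero_add, mul_one, add_zero] at h3
    have h4 : Θ x * (k * (deriv h (H x))⁻¹) = Θ x * (D 1 2 * (q 2).eval (H x) - b * a -
        b / a * (k * H x + l) ^ 2) := by
      linear_combination -h3
    have h5 := mul_left_cancel₀ (hne x) h4
    rw [hw]
    simp only [eval_sub, eval_add, eval_mul, eval_C, eval_X, eval_pow]
    rw [← h5, inv_mul_cancel_left₀ hk0]
  have hd : ∀ x, HasDerivAt H (w.eval (H x)) x := fun x => hHw x ▸ hsys.map.hasDerivAt x
  obtain ⟨κ, c, hκ, hH⟩ := exists_eq_tanh_of_quadratic hwdeg hd hsys.map.mem_Ioo (fun t ht => by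
    have := hHw (h t)
    rw [hsys.map.left_inv ht] at this
    rw [← this]
    exact inv_pos.2 (hsys.map.deriv_pos t ht))
  exact ⟨κ, c, b / a * l, b / a * k, hκ, hH, hΘ, hne⟩

/-! ### Square-integrability determines the range of the parameters -/

lemma tanhFactor_swap (α β κ c x : ℝ) : tanhFactor α β κ c (-x) = tanhFactor β α κ (-c) x := by
  rw [tanhFactor, tanhFactor, show κ * -x + c = -(κ * x + -c) by ring, Real.tanh_neg]
  ring_nf

lemma neg_one_lt_of_memLp_tanhFactor {α β κ c : ℝ} (hκ : 0 < κ)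
    (hL : MemLp (tanhFactor α β κ c) 2 volume) : -1 < α := by
  by_contra! hα
  have hint := hL.integrable_sq
  set ε : ℝ := √κ * min 1 (2 ^ ((β + 1) / 2)) with hε
  have hε0 : 0 < ε :=
    mul_pos (Real.sqrt_pos.2 hκ) (lt_min one_pos (Real.rpow_pos_of_pos two_pos _))
  have hbound : ∀ x ∈ Ici (-c / κ), ε ^ 2 ≤ tanhFactor α β κ c x ^ 2 := by
    intro x hx
    have hx' : 0 ≤ κ * x + c := by
      have := (div_le_iff₀ hκ).1 (mem_Ici.1 hx)
      linarith
    have h0 : 0 ≤ Real.tanh (κ * x + c) := by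
      rw [Real.tanh_eq_sinh_div_cosh]
      exact div_nonneg (Real.sinh_nonneg_iff.2 hx') (Real.cosh_pos _).le
    have h1 := Real.tanh_lt_one (κ * x + c)
    have e1 : 1 ≤ (1 - Real.tanh (κ * x + c)) ^ ((α + 1) / 2) :=
      Real.one_le_rpow_of_pos_of_le_one_of_nonpos (by linarith) (by linarith) (by linarith)
    have e2 : min 1 (2 ^ ((β + 1) / 2)) ≤ (1 + Real.tanh (κ * x + c)) ^ ((β + 1) / 2) := by
      rcases le_total 0 ((β + 1) / 2) with hb | hb
      · exact (min_le_left _ _).trans (Real.one_le_rpow (by linarith) hb)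
      · exact (min_le_right _ _).trans
          (Real.rpow_le_rpow_of_nonpos (by linarith) (by linarith) hb)
    refine pow_le_pow_left₀ hε0.le ?_ 2
    rw [hε, tanhFactor]
    refine mul_le_mul_of_nonneg_left ?_ (Real.sqrt_nonneg _)
    exact e2.trans (le_mul_of_one_le_left (Real.rpow_nonneg (by linarith) _) e1)
  have hconst : IntegrableOn (fun _ : ℝ => ε ^ 2) (Ici (-c / κ)) := by
    refine (hint.integrableOn (s := Ici (-c / κ))).mono' aestronglyMeasurable_const ?_
    filter_upwards [ae_restrict_mem measurableSet_Ici] with x hx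
    rw [Real.norm_of_nonneg (by positivity)]
    exact hbound x hx
  rw [integrableOn_const_iff] at hconst
  simp [hε0.ne'] at hconst

lemma neg_one_lt_right_of_memLp_tanhFactor {α β κ c : ℝ} (hκ : 0 < κ)
    (hL : MemLp (tanhFactor α β κ c) 2 volume) : -1 < β := by
  refine neg_one_lt_of_memLp_tanhFactor (β := α) (c := -c) hκ ?_
  have := hL.comp_measurePreserving (Measure.measurePreserving_neg volume)
  exact (funext (tanhFactor_swap α β κ c)) ▸ this

/-- A solution of the equation for `Θ` is a multiple of a `tanhFactor`. -/
lemma exists_eq_tanhFactor {Θ : ℝ → ℝ} {κ c A B : ℝ} (hκ : 0 < κ)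
    (hΘ : ∀ x, HasDerivAt Θ ((A + B * Real.tanh (κ * x + c)) * Θ x) x) :
    ∃ α β K : ℝ, ∀ x, Θ x = K * tanhFactor α β κ c x := by
  -- The logarithmic derivative of `tanhFactor` is `κ / 2 * ((β - α) - (α + β + 2) * tanh)`.
  obtain ⟨α, hα⟩ : ∃ α : ℝ, κ * (α + 1) = -(A + B) := ⟨-(A + B) / κ - 1, by field_simp; ring⟩
  obtain ⟨β, hβ⟩ : ∃ β : ℝ, κ * (β + 1) = A - B := ⟨(A - B) / κ - 1, by field_simp; ring⟩
  have hpos := tanhFactor_pos α β hκ c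
  have hd : ∀ x, HasDerivAt (fun x => Θ x / tanhFactor α β κ c x) 0 x := by
    intro x
    refine ((hΘ x).div (hasDerivAt_tanhFactor α β κ c x) (hpos x).ne').congr_deriv ?_
    rw [div_eq_zero_iff]
    left
    simp only [pearsonPoly, eval_sub, eval_mul, eval_C, eval_X]
    linear_combination (Θ x * tanhFactor α β κ c x / 2) * ((1 + Real.tanh (κ * x + c)) * hα -
      (1 - Real.tanh (κ * x + c)) * hβ)
  refine ⟨α, β, Θ 0 / tanhFactor α β κ c 0, fun x => ?_⟩
  have hconst := is_const_of_deriv_eq_zero (fun y => (hd y).differentiableAt)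
    (fun y => (hd y).deriv) x 0
  rw [← hconst, div_mul_cancel₀ _ (hpos x).ne']

/-! ### Identification of the system and of its matrix -/

/-- The entries above the diagonal are determined by the functions, row by row. -/
lemma superdiagonal_eq {φ : ℕ → ℝ → ℝ} {D : Matrix ℕ ℕ ℝ} (hD : IsSkewTridiagonalIrreducible D)
    (hφ : IsDifferentiationMatrix D φ) {α β κ c : ℝ} {s : ℕ → ℝ} (hα : -1 < α) (hβ : -1 < β)
    (hκ : 0 < κ) (hs : ∀ m, s m = 1 ∨ s m = -1)
    (hφs : ∀ m x, φ m x = s m * (√κ * tanhJacobi α β m (κ * x + c))) (m : ℕ) :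
    D m (m + 1) = s m * s (m + 1) * (κ * tanhJacobiCoeff α β m) := by
  have hfun : ∀ m, φ m = fun x => s m * (√κ * tanhJacobi α β m (κ * x + c)) :=
    fun m => funext (hφs m)
  have hss : ∀ m, s m * s m = 1 := fun m => mul_self_eq_one_iff.2 (hs m)
  have hne : ∀ m, ∃ x, √κ * tanhJacobi α β m (κ * x + c) ≠ 0 := by
    intro m
    by_contra! hzero
    have h := integral_tanhJacobi_mul hα hβ hκ c m m
    simp [hzero] at h
  induction m with
  | zero =>
    obtain ⟨x, hx⟩ := hne 1
    have h1 := hasDerivAt_zero_of_tridiagonal hD hφ x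
    have h2 := (hasDerivAt_tanhJacobi_zero hα hβ κ c x).const_mul (s 0)
    rw [hfun 0] at h1
    have h3 := h1.unique h2
    rw [hφs 1] at h3
    refine mul_right_cancel₀ hx ?_
    rw [zero_add]
    linear_combination s 1 * h3 - D 0 1 * (√κ * tanhJacobi α β 1 (κ * x + c)) * hss 1
  | succ m ih =>
    obtain ⟨x, hx⟩ := hne (m + 2)
    have h1 := hasDerivAt_succ_of_tridiagonal hD hφ m x
    have h2 := (hasDerivAt_tanhJacobi_succ hα hβ κ c m x).const_mul (s (m + 1))
    rw [hfun (m + 1)] at h1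
    have h3 := h1.unique h2
    rw [hφs (m + 2), hφs m, ih] at h3
    refine mul_right_cancel₀ hx ?_
    change D (m + 1) (m + 2) * _ = s (m + 1) * s (m + 2) * _ * _
    linear_combination s (m + 2) * h3 -
      D (m + 1) (m + 2) * (√κ * tanhJacobi α β (m + 2) (κ * x + c)) * hss (m + 2) +
      s (m + 2) * s (m + 1) * (κ * tanhJacobiCoeff α β m) *
        (√κ * tanhJacobi α β m (κ * x + c)) * hss m

lemma isAffineTanhJacobi_of_mapped {φ : ℕ → ℝ → ℝ} {D : Matrix ℕ ℕ ℝ} {W h H Θ : ℝ → ℝ}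
    {q : ℕ → ℝ[X]} (hsys : IsMappedPolySystem W q h H Θ φ) (horth : IsOrthonormalSystem φ)
    (hD : IsSkewTridiagonalIrreducible D) (hφ : IsDifferentiationMatrix D φ) :
    IsAffineTanhJacobi φ D := by
  obtain ⟨κ, c, A, B, hκ, hH, hΘ, hne⟩ := exists_eq_tanh_of_mapped hsys horth hD hφ
  simp only [hH] at hΘ
  obtain ⟨α, β, K, hΘK⟩ := exists_eq_tanhFactor hκ hΘ
  have hK : K ≠ 0 := fun h0 => hne 0 (by rw [hΘK, h0, zero_mul])
  have hqdeg := hsys.orthonormal.degree_eq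
  have hL : MemLp (tanhFactor α β κ c) 2 volume := by
    have hq0 := eq_C_of_degree_eq_zero (hqdeg 0)
    have ha : (q 0).coeff 0 ≠ 0 := fun h0 => by
      have := hqdeg 0
      rw [hq0, h0] at this
      simp at this
    have := (horth.memLp 0).const_mul (K * (q 0).coeff 0)⁻¹
    convert this using 2 with x
    rw [hsys.eq, hq0, hΘK, eval_C, coeff_C_zero]
    field_simp
  have hα := neg_one_lt_of_memLp_tanhFactor hκ hL
  have hβ := neg_one_lt_right_of_memLp_tanhFactor hκ hL
  let ℓ : ℝ[X] →ₗ[ℝ] ℝ :=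
    { toFun := jacobiIntegral α β
      map_add' := jacobiIntegral_add hα hβ
      map_smul' := fun a p => by
        rw [smul_eq_C_mul, jacobiIntegral_C_mul, RingHom.id_apply, smul_eq_mul] }
  -- In the variable `t = tanh (κ x + c)`, the polynomials `K q_m` are orthonormal for the Jacobi weight.
  have hsign := eq_or_eq_neg_of_orthonormal ℓ (fun r hr => jacobiIntegral_mul_self_pos hα hβ hr)
    (degree_jacobiOrthonormal hα hβ) (jacobiIntegral_jacobiOrthonormal hα hβ)
    (q := fun m => C K * q m) (fun m => by rw [degree_C_mul hK, hqdeg])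
    (fun m n => by
      change jacobiIntegral α β _ = _
      rw [← horth.integral_eq m n, ← integral_tanhFactor_sq_mul α β hκ c]
      congr 1
      funext x
      rw [hsys.eq, hsys.eq, hΘK, hH]
      simp only [eval_mul, eval_C]
      ring)
  have hs : ∀ m, ∃ s : ℝ, (s = 1 ∨ s = -1) ∧ C K * q m = C s * jacobiOrthonormal α β m := by
    intro m
    rcases hsign m with h | h
    · exact ⟨1, Or.inl rfl, by rw [h, C_1, one_mul]⟩
    · exact ⟨-1, Or.inr rfl, by rw [h, C_neg, C_1, neg_one_mul]⟩
  choose s hs1 hs2 using hs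
  have hφs : ∀ m x, φ m x = s m * (√κ * tanhJacobi α β m (κ * x + c)) := by
    intro m x
    have h := congrArg (eval (Real.tanh (κ * x + c))) (hs2 m)
    simp only [eval_mul, eval_C] at h
    rw [hsys.eq, hΘK, hH, sqrt_mul_tanhJacobi]
    linear_combination tanhFactor α β κ c x * h
  have hsup := superdiagonal_eq hD hφ hα hβ hκ hs1 hφs
  refine ⟨α, β, κ, c, s, hα, hβ, hκ, hs1, hφs, fun m n => ?_, fun hpos m => ?_⟩
  · split_ifs with h1 h2
    · rw [h1, hsup]
    · rw [h2, hD.skew, hsup]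
      ring
    · rcases lt_trichotomy m n with h | h | h
      · exact hD.tridiagonal m n (Or.inl (by omega))
      · rw [h]
        linarith [hD.skew n n]
      · exact hD.tridiagonal m n (Or.inr (by omega))
  · induction m with
    | zero => rfl
    | succ m ih =>
      have h := hpos m
      rw [hsup, ih] at h
      have h' := pos_of_mul_pos_left h (mul_pos hκ (tanhJacobiCoeff_pos hα hβ m)).le
      rcases hs1 0 with h0 | h0 <;> rcases hs1 (m + 1) with hm | hm <;> rw [h0, hm] at h' ⊢ <;>
        norm_num at h'

end

theorem theorem1 (φ : ℕ → ℝ → ℝ) (D : Matrix ℕ ℕ ℝ) :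
    -- every system of the required kind is an affinely transformed tanh-Jacobi system
    (∀ (W : ℝ → ℝ) (q : ℕ → ℝ[X]) (h H Θ : ℝ → ℝ),
      IsMappedPolySystem W q h H Θ φ → IsOrthonormalSystem φ →
      IsSkewTridiagonalIrreducible D → IsDifferentiationMatrix D φ →
      IsAffineTanhJacobi φ D) ∧
    -- and every affinely transformed tanh-Jacobi system is of the required kind
    (IsAffineTanhJacobi φ D →
      (∃ (W : ℝ → ℝ) (q : ℕ → ℝ[X]) (h H Θ θ : ℝ → ℝ),
        IsMappedPolySystem W q h H Θ φ ∧ IsCoefficientFactor W h H Θ θ) ∧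
      IsOrthonormalSystem φ ∧ IsSkewTridiagonalIrreducible D ∧ IsDifferentiationMatrix D φ) := by
  refine ⟨fun W q h H Θ hsys horth hD hφ => isAffineTanhJacobi_of_mapped hsys horth hD hφ,
    fun hφ => ⟨hφ.exists_isMappedPolySystem, hφ.isOrthonormalSystem,
      hφ.isSkewTridiagonalIrreducible, hφ.isDifferentiationMatrix⟩⟩
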